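/- **Setting.** A *single-query PIR* with $s\ge 1$ servers is a two-message protocol: each server holds $\mathsf{DB}\in\{0,1\}^n$; from an index $i$ and random bits the client computes one message per server, each server answers, and the client reconstructs $\mathsf{DB}_i$ (always correctly). $\Pi=(\Pi_{\lambda,n})$ is a family of such protocols, indexed by a security parameter $\lambda$ and the database size $n$. Communication is the total number of bits exchanged; computation is the total work of the servers in answering, measured as Boolean circuit size (NAND gates). A *re-usable batch PIR* samples public parameters once; the servers' database is encoded with these parameters (encoding may fail, $E=\bot$), and a client with a set $Q\subseteq[n]$, $|Q|\le q$, runs a two-message protocol with the servers to obtain $(\mathsf{DB}_i)_{i\in Q}$. It has *adversarial error* $\epsilon$ if for every randomized adversary that sees the public parameters and then outputs $(\mathsf{DB},Q)$, the probability that $E=\bot$ or that the client's output is not $(\mathsf{DB}_i)_{i\in Q}$ is at most $\epsilon$. It is $(s,s_{\mathcal A},\delta)$-*secure* if for every exponent $d$ and all sufficiently large $\lambda$, for all admissible database sizes $n\le\lambda^d$, every randomized non-uniform adversary that (knowing the public parameters) chooses a database, two queries of size at most $q$ and at most $s_{\mathcal A}$ servers to corrupt, and then guesses from the corrupted servers'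 transcripts with a circuit of size at most $\lambda^d$ which of the two queries was made, has distinguishing advantage at most $\delta$. Security of single-query PIR is the same with two indices in place of the two query sets and no public parameters; there $\delta=\delta(\lambda,n)$. **Theorem.** Let $f:\mathbb N\to\mathbb N$ with $f(n)=\omega(\log n)$ and put $k=k(n,\lambda)=f(n)+\lambda$. There are constants $C,n_0$, depending only on $f$, and for all $\lambda,n,q$ a batch code of the following form. There are $k'$ disjoint sub-tables of $w$ buckets each, and $k'$ public, independent, uniformly random hash functions $H_j:[n]\to[w]$. Entry $x$ is replicated into bucket $H_j(x)$ of the $j$-th sub-table for every $j$. All buckets are padded to a common size $M=M(\lambda,n,q)$, and encoding fails if some bucket holds more than $M$ entries. A scheduling algorithm chooses, from the hash functions and $Q$, at most one entry to be read from each bucket. For all $\lambda$, all $n\ge n_0$ and all $1\le q\le n$, $$k'\le C\,k,\qquad k'w\le C\,q,\qquad M\le C\left(\frac{nk}{q}+\lambda\right),$$ and the batch PIR obtained by running $\Pi_{\lambda,M}$ once, with fresh random bits, in each of the $k'w$ buckets (at a dummy position where nothing is scheduled) has the following properties for every single-query PIR family $\Pi$: 1. it has adversarial error at most $2^{-\lambda}$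 for queries of size at most $q$, even against computationally unbounded adversaries, hence in particular against every PPT adversary that chooses the database and the query knowing the public hash functions; 2. if $\Pi_{\lambda,m}$ has communication at most $c(\lambda,m)$ for all $m \ge 1$, then its communication is at most $C\,q\cdot c(\lambda,M)$, that is, $O(q)\cdot c(\lambda,O(nk/q+\lambda))$; 3. if $\Pi_{\lambda,m}$ has computation at most $t(\lambda)\,m$ for all $m\ge 1$, then its computation is at most $C\,t(\lambda)\,nk$; 4. if the client algorithms of $\Pi$ have circuits, and its strings have length, polynomial in $\lambda$ and the database size, then encoding and the client algorithms of the batch PIR have circuits, and its strings have length, polynomial in $\lambda+n$; 5. if $\Pi$ is $(s,s_{\mathcal A},\delta)$-secure, then the batch PIR (for $n\ge n_0$, $1\le q\le n$) is $(s,s_{\mathcal A},\delta')$-secure with $\delta'(\lambda,n,q)=C\,q\,\delta(\lambda,M)$. -/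

import Mathlib

open Filter Asymptotics

/-! ### Boolean circuits

A circuit with input wires `inp i : X → Bool` is a list of gates, each of them the NAND of two wires
that are already available. A wire is recorded by the Boolean function of the input that it carries. -/

/-- The wires available after the gates `L`: input wires, constants, and outputs of gates of `L`. -/
def IsWire {X ι : Type*} (inp : ι → X → Bool) (L : List (X → Bool)) (g : X → Bool) : Prop :=
  (∃ i, g = inp i) ∨ (∃ v : Bool, g = fun _ => v) ∨ g ∈ L

/-- `L` lists (last gate first) the gates of a Boolean circuit over the NAND basis. -/
inductive IsCircuit {X ι : Type*} (inp : ι → X → Bool) : List (X → Bool) → Prop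
  | nil : IsCircuit inp []
  | gate {L : List (X → Bool)} {g h : X → Bool} (hL : IsCircuit inp L)
      (hg : IsWire inp L g) (hh : IsWire inp L h) :
      IsCircuit inp ((fun x => !(g x && h x)) :: L)

/-- Some Boolean circuit with at most `T` gates computes all the outputs `out o` from the
inputs `inp i`. -/
def HasCircuit {X ι κ : Type*} (T : ℕ) (inp : ι → X → Bool) (out : κ → X → Bool) : Prop :=
  ∃ L : List (X → Bool), IsCircuit inp L ∧ L.length ≤ T ∧ ∀ o, IsWire inp L (out o)

/-! ### Probability over uniform finite randomness -/

/-- The expectation of `g` over a uniformly random element of `Ω`. -/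
noncomputable def uavg {Ω : Type*} [Fintype Ω] (g : Ω → ℝ) : ℝ :=
  (∑ x, g x) / (Fintype.card Ω : ℝ)

open Classical in
/-- The indicator of an event. -/
noncomputable def ind (p : Prop) : ℝ := if p then 1 else 0

/-! ### Single-query PIR -/

/-- A single-query PIR protocol with `s` servers, each holding the database in `{0,1}^n`. The client
sends one message to every server, receives one answer from each, and reconstructs the entry. -/
structure PIR (s n : ℕ) where
  /-- indexes the client's random bits -/
  Coin : Type
  [coinFintype : Fintype Coin]
  [coinDecEq : DecidableEq Coin]
  /-- indexes the bits of the message to server `j` -/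
  Up : Fin s → Type
  [upFintype : ∀ j, Fintype (Up j)]
  /-- indexes the bits of the answer of server `j` -/
  Down : Fin s → Type
  [downFintype : ∀ j, Fintype (Down j)]
  query : Fin n → (Coin → Bool) → (j : Fin s) → Up j → Bool
  answer : (j : Fin s) → (Fin n → Bool) → (Up j → Bool) → Down j → Bool
  recon : Fin n → (Coin → Bool) → ((j : Fin s) → Down j → Bool) → Bool

attribute [instance] PIR.coinFintype PIR.coinDecEq PIR.upFintype PIR.downFintype

/-- An attack on the privacy of a protocol whose transcript with server `j` has bits indexed by
`W j`: a database, two challenge queries of type `I`, the set of corrupted servers, and the final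
guess. -/
structure Attack (s n : ℕ) (I : Type) (W : Fin s → Type) where
  db : Fin n → Bool
  q₀ : I
  q₁ : I
  corrupt : Finset (Fin s)
  guess : ((j : Fin s) → W j → Bool) → Bool

/-- At most `sA` servers are corrupted, and the guess is computed by a circuit with at most `T`
gates from the transcripts with the corrupted servers alone. -/
def Attack.Admissible {s n : ℕ} {I : Type} {W : Fin s → Type} (A : Attack s n I W) (sA T : ℕ) :
    Prop :=
  A.corrupt.card ≤ sA ∧
    HasCircuit T (fun (a : Σ j : {j : Fin s // j ∈ A.corrupt}, W j.1) tr => tr a.1.1 a.2)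
      (fun (_ : Unit) tr => A.guess tr)

namespace PIR

variable {s n : ℕ} (P : PIR s n)

/-- The answers of all servers to a client that retrieves entry `i` with random bits `ω`. -/
def answers (db : Fin n → Bool) (i : Fin n) (ω : P.Coin → Bool) (j : Fin s) : P.Down j → Bool :=
  P.answer j db (P.query i ω j)

def Correct : Prop :=
  ∀ (db : Fin n → Bool) (i : Fin n) (ω : P.Coin → Bool), P.recon i ω (P.answers db i ω) = db i

/-- The total number of bits exchanged in one execution. -/
def comm : ℕ := ∑ j, (Fintype.card (P.Up j) + Fintype.card (P.Down j))

/-- The servers compute their answers with at most `T` gates in total. -/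
def ServerWork (T : ℕ) : Prop :=
  ∃ size : Fin s → ℕ, ∑ j, size j ≤ T ∧
    ∀ j, HasCircuit (X := (Fin n → Bool) × (P.Up j → Bool)) (size j)
      (Sum.elim (fun (a : Fin n) x => x.1 a) (fun (u : P.Up j) x => x.2 u))
      (fun (e : P.Down j) x => P.answer j x.1 x.2 e)

/-- All strings have length at most `T`, and the client's two algorithms have circuits with at most
`T` gates. The queried index is given in unary, by the bits `i = a`. -/
def EfficientWithin (T : ℕ) : Prop :=
  Fintype.card P.Coin ≤ T ∧ (∀ j, Fintype.card (P.Up j) ≤ T) ∧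
  (∀ j, Fintype.card (P.Down j) ≤ T) ∧
  HasCircuit (X := Fin n × (P.Coin → Bool)) T
    (Sum.elim (fun (a : Fin n) x => decide (x.1 = a)) (fun (r : P.Coin) x => x.2 r))
    (fun (o : Σ j, P.Up j) x => P.query x.1 x.2 o.1 o.2) ∧
  HasCircuit (X := Fin n × (P.Coin → Bool) × ((j : Fin s) → P.Down j → Bool)) T
    (Sum.elim (fun (a : Fin n) x => decide (x.1 = a))
      (Sum.elim (fun (r : P.Coin) x => x.2.1 r) (fun (o : Σ j, P.Down j) x => x.2.2 o.1 o.2)))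
    (fun (_ : Unit) x => P.recon x.1 x.2.1 x.2.2)

/-- The transcript with each server: the message to it followed by its answer. -/
def transcript (db : Fin n → Bool) (i : Fin n) (ω : P.Coin → Bool) (j : Fin s) :
    P.Up j ⊕ P.Down j → Bool :=
  Sum.elim (P.query i ω j) (P.answers db i ω j)

/-- The probability that the attack `A` guesses `1` when the client retrieves entry `i`. -/
noncomputable def guessProb (A : Attack s n (Fin n) (fun j => P.Up j ⊕ P.Down j)) (i : Fin n) : ℝ :=
  uavg fun ω : P.Coin → Bool => ind (A.guess (P.transcript A.db i ω) = true)

/-- Every randomized adversary that corrupts at most `sA` servers and guesses with a circuit of size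
at most `T` has distinguishing advantage at most `ε`. -/
def PrivateWithin (sA T : ℕ) (ε : ℝ) : Prop :=
  ∀ (r : ℕ) (A : (Fin r → Bool) → Attack s n (Fin n) (fun j => P.Up j ⊕ P.Down j)),
    (∀ ρ, (A ρ).Admissible sA T) →
    |uavg (fun ρ => P.guessProb (A ρ) (A ρ).q₀) - uavg (fun ρ => P.guessProb (A ρ) (A ρ).q₁)| ≤ ε

end PIR

/-- `(s, sA, δ)`-security of a family of single-query PIR protocols, indexed by the security
parameter and the database size, against adversaries of polynomial size in the security parameter. -/
def SecurePIR {s : ℕ} (P : ℕ → (n : ℕ) → PIR s n) (sA : ℕ) (δ : ℕ → ℕ → ℝ) : Prop :=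
  ∀ d : ℕ, ∃ lam₀ : ℕ, ∀ lam ≥ lam₀, ∀ n : ℕ, 1 ≤ n → n ≤ lam ^ d →
    (P lam n).PrivateWithin sA (lam ^ d) (δ lam n)

/-! ### Batch PIR -/

/-- A batch PIR protocol with `s` servers and databases in `{0,1}^n`. The public parameters are
sampled once by `init`; the servers hold the encoded database (`none` is a failure to encode). -/
structure BatchPIR (s n : ℕ) where
  Prms : Type
  [prmsFintype : Fintype Prms]
  init : PMF Prms
  /-- indexes the bits that represent the parameters -/
  PrmIx : Type
  [prmIxFintype : Fintype PrmIx]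
  prmBit : PrmIx → Prms → Bool
  prmBit_injective : Function.Injective fun (p : Prms) (a : PrmIx) => prmBit a p
  /-- indexes the bits of the encoded database -/
  Enc : Type
  [encFintype : Fintype Enc]
  encode : Prms → (Fin n → Bool) → Option (Enc → Bool)
  Coin : Type
  [coinFintype : Fintype Coin]
  [coinDecEq : DecidableEq Coin]
  Up : Fin s → Type
  [upFintype : ∀ j, Fintype (Up j)]
  Down : Fin s → Type
  [downFintype : ∀ j, Fintype (Down j)]
  query : Prms → Finset (Fin n) → (Coin → Bool) → (j : Fin s) → Up j → Bool
  answer : (j : Fin s) → Prms → (Enc → Bool) → (Up j → Bool) → Down j → Bool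
  /-- the client's output at `x`, meaningful for `x` in the queried set -/
  recon : Prms → Finset (Fin n) → (Coin → Bool) → ((j : Fin s) → Down j → Bool) → Fin n → Bool

attribute [instance] BatchPIR.prmsFintype BatchPIR.prmIxFintype BatchPIR.encFintype
  BatchPIR.coinFintype BatchPIR.coinDecEq BatchPIR.upFintype BatchPIR.downFintype

namespace BatchPIR

variable {s n : ℕ} (S : BatchPIR s n)

def answers (p : S.Prms) (E : S.Enc → Bool) (Q : Finset (Fin n)) (ω : S.Coin → Bool)
    (j : Fin s) : S.Down j → Bool :=
  S.answer j p E (S.query p Q ω j)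

/-- The total number of bits exchanged in one execution of the query protocol. -/
def comm : ℕ := ∑ j, (Fintype.card (S.Up j) + Fintype.card (S.Down j))

/-- The servers compute their answers, from the parameters, the encoded database and the client's
messages, with at most `T` gates in total. -/
def ServerWork (T : ℕ) : Prop :=
  ∃ size : Fin s → ℕ, ∑ j, size j ≤ T ∧
    ∀ j, HasCircuit (X := S.Prms × (S.Enc → Bool) × (S.Up j → Bool)) (size j)
      (Sum.elim (fun (a : S.PrmIx) x => S.prmBit a x.1)
        (Sum.elim (fun (e : S.Enc) x => x.2.1 e) (fun (u : S.Up j) x => x.2.2 u)))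
      (fun (e : S.Down j) x => S.answer j x.1 x.2.1 x.2.2 e)

/-- All strings have length at most `T`, and encoding and the client's two algorithms have circuits
with at most `T` gates. -/
def EfficientWithin (T : ℕ) : Prop :=
  Fintype.card S.PrmIx ≤ T ∧ Fintype.card S.Enc ≤ T ∧ Fintype.card S.Coin ≤ T ∧
  (∀ j, Fintype.card (S.Up j) ≤ T) ∧ (∀ j, Fintype.card (S.Down j) ≤ T) ∧
  HasCircuit (X := S.Prms × (Fin n → Bool)) T
    (Sum.elim (fun (a : S.PrmIx) x => S.prmBit a x.1) (fun (a : Fin n) x => x.2 a))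
    (Sum.elim (fun (_ : Unit) x => (S.encode x.1 x.2).isSome)
      (fun (e : S.Enc) x => (S.encode x.1 x.2).getD (fun _ => false) e)) ∧
  HasCircuit (X := S.Prms × Finset (Fin n) × (S.Coin → Bool)) T
    (Sum.elim (fun (a : S.PrmIx) x => S.prmBit a x.1)
      (Sum.elim (fun (a : Fin n) x => decide (a ∈ x.2.1)) (fun (r : S.Coin) x => x.2.2 r)))
    (fun (o : Σ j, S.Up j) x => S.query x.1 x.2.1 x.2.2 o.1 o.2) ∧
  HasCircuit (X := S.Prms × Finset (Fin n) × (S.Coin → Bool) × ((j : Fin s) → S.Down j → Bool)) T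
    (Sum.elim (fun (a : S.PrmIx) x => S.prmBit a x.1)
      (Sum.elim (fun (a : Fin n) x => decide (a ∈ x.2.1))
        (Sum.elim (fun (r : S.Coin) x => x.2.2.1 r)
          (fun (o : Σ j, S.Down j) x => x.2.2.2 o.1 o.2))))
    (fun (a : Fin n) x => S.recon x.1 x.2.1 x.2.2.1 x.2.2.2 a)

/-- With parameters `p`, random bits `ω`, database `db` and query `Q`: the database fails to encode,
or the client's output differs from `db` at some index in `Q`. -/
def Errs (p : S.Prms) (ω : S.Coin → Bool) (db : Fin n → Bool) (Q : Finset (Fin n)) : Prop :=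
  match S.encode p db with
  | none => True
  | some E => ∃ x ∈ Q, S.recon p Q ω (S.answers p E Q ω) x ≠ db x

/-- Adversarial error at most `ε` for queries of size at most `q`. The adversary sees the public
parameters and then chooses the database and the query; it is randomized and its computing power is
not limited, so that in particular all probabilistic polynomial-time adversaries are covered. -/
def AdversarialError (q : ℕ) (ε : ℝ) : Prop :=
  ∀ (r : ℕ) (A : (Fin r → Bool) → S.Prms → (Fin n → Bool) × Finset (Fin n)),
    (∀ ρ p, (A ρ p).2.card ≤ q) →
    (uavg fun ρ => ∑ p, (S.init p).toReal *
      uavg fun ω : S.Coin → Bool => ind (S.Errs p ω (A ρ p).1 (A ρ p).2)) ≤ ε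

def transcript (p : S.Prms) (E : S.Enc → Bool) (Q : Finset (Fin n)) (ω : S.Coin → Bool)
    (j : Fin s) : S.Up j ⊕ S.Down j → Bool :=
  Sum.elim (S.query p Q ω j) (S.answers p E Q ω j)

/-- The probability, for parameters `p`, that the attack `A` guesses `1` when the client queries `Q`.
If the database fails to encode, then there is no execution and the guess counts as `0`. -/
noncomputable def guessProb (p : S.Prms)
    (A : Attack s n (Finset (Fin n)) (fun j => S.Up j ⊕ S.Down j)) (Q : Finset (Fin n)) : ℝ :=
  match S.encode p A.db with
  | none => 0
  | some E => uavg fun ω : S.Coin → Bool => ind (A.guess (S.transcript p E Q ω) = true)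

/-- Every randomized adversary that, knowing the public parameters, chooses a database, two queries
of size at most `q` and at most `sA` servers to corrupt, and then guesses with a circuit of size at
most `T` (which may depend on its state after the first phase), has advantage at most `ε`. -/
def PrivateWithin (q sA T : ℕ) (ε : ℝ) : Prop :=
  ∀ (r : ℕ) (A : (Fin r → Bool) → S.Prms →
      Attack s n (Finset (Fin n)) (fun j => S.Up j ⊕ S.Down j)),
    (∀ ρ p, (A ρ p).q₀.card ≤ q ∧ (A ρ p).q₁.card ≤ q ∧ (A ρ p).Admissible sA T) →
    |(uavg fun ρ => ∑ p, (S.init p).toReal * S.guessProb p (A ρ p) (A ρ p).q₀) -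
      (uavg fun ρ => ∑ p, (S.init p).toReal * S.guessProb p (A ρ p) (A ρ p).q₁)| ≤ ε

end BatchPIR

/-! ### Batch codes from cuckoo hashing and their composition with single-query PIR -/

/-- A systematic batch code from cuckoo hashing: there are `k` disjoint sub-tables of `w` buckets
each, and the `j`-th hash function sends each of the `n` database indices to a bucket of the `j`-th
sub-table. A bucket holds at most `cap` entries. Given the hash functions and a set of queried
indices, `schedule` selects at most one index to be read from each bucket. -/
structure CuckooCode (n : ℕ) where
  k : ℕ
  w : ℕ
  cap : ℕ
  w_pos : 0 < w
  cap_pos : 0 < cap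
  schedule : (Fin k → Fin n → Fin w) → Finset (Fin n) → Fin k × Fin w → Option (Fin n)

namespace CuckooCode

variable {n : ℕ} (B : CuckooCode n)

instance : NeZero B.w := ⟨B.w_pos.ne'⟩

/-- The hash functions, which are public. -/
abbrev Hash : Type := Fin B.k → Fin n → Fin B.w

abbrev Bucket : Type := Fin B.k × Fin B.w

/-- The database indices that are replicated into bucket `u`. -/
def members (H : B.Hash) (u : B.Bucket) : Finset (Fin n) :=
  Finset.univ.filter fun x => H u.1 x = u.2

/-- The position of `x` in bucket `u`, where the members are stored in increasing order. -/
def rank (H : B.Hash) (u : B.Bucket) (x : Fin n) : ℕ :=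
  ((B.members H u).filter fun y => y < x).card

/-- Every bucket is padded with zeros to length `cap`; encoding fails if some bucket overflows. -/
def encode (H : B.Hash) (db : Fin n → Bool) : Option (B.Bucket × Fin B.cap → Bool) :=
  if ∀ u, (B.members H u).card ≤ B.cap then
    some fun a => decide (∃ x ∈ B.members H a.1, B.rank H a.1 x = a.2.val ∧ db x = true)
  else none

/-- The position that is read in bucket `u`; a dummy position if nothing is scheduled there. -/
def slot (H : B.Hash) (Q : Finset (Fin n)) (u : B.Bucket) : Fin B.cap :=
  match B.schedule H Q u with
  | some x => if h : B.rank H u x < B.cap then ⟨B.rank H u x, h⟩ else ⟨0, B.cap_pos⟩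
  | none => ⟨0, B.cap_pos⟩

/-- Batch PIR from the batch code `B` and a single-query PIR: the parameters are uniformly random
hash functions, and the client runs the single-query protocol, with fresh random bits, once in every
bucket. -/
noncomputable def batchPIR {s : ℕ} (P : PIR s B.cap) : BatchPIR s n where
  Prms := B.Hash
  init := PMF.uniformOfFintype B.Hash
  PrmIx := Fin B.k × Fin n × Fin B.w
  prmBit := fun a H => decide (H a.1 a.2.1 = a.2.2)
  prmBit_injective := by
    intro H H' h
    funext j x
    have h1 := congrFun h (j, x, H j x)
    simp only [decide_true] at h1
    exact (of_decide_eq_true h1.symm).symm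
  Enc := B.Bucket × Fin B.cap
  encode := B.encode
  Coin := B.Bucket × P.Coin
  Up := fun j => B.Bucket × P.Up j
  Down := fun j => B.Bucket × P.Down j
  query := fun H Q ω j a => P.query (B.slot H Q a.1) (fun r => ω (a.1, r)) j a.2
  answer := fun j _ E m a => P.answer j (fun i => E (a.1, i)) (fun v => m (a.1, v)) a.2
  recon := fun H Q ω ans x => decide (∃ u, B.schedule H Q u = some x ∧
    P.recon (B.slot H Q u) (fun r => ω (u, r)) (fun j e => ans j (u, e)) = true)

end CuckooCode

/-! Write K = f n + lam. Call the hash functions bad if some bucket overflows, or if some set of at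
most q entries has fewer buckets available than elements. If they are not bad, they serve every
database and every query simultaneously: nothing overflows, and Hall's condition lets each query be
matched into distinct buckets. Seeing the hash functions therefore does not help the adversary, and
the error is at most the probability of `CuckooCode.Bad`.

That probability is bounded by unions. With m = k * w buckets in all, a fixed pair of t entries and
t buckets is a violation with probability at most (t / m) ^ (k * t), by AM-GM over the sub-tables.
There are at most n ^ t * (3 * m / t) ^ t pairs, which leaves (3 * n * (t / m) ^ (k - 1)) ^ t. Now t
/ m ≤ 1/2 because 2 * q ≤ m, and n ≤ 2 ^ f n (the only use of the growth of f), so with k = K + 5 a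
geometric series remains (`uavg_ind_hall_le`). Overflow is a first-moment bound over sets of `cap`
entries (`uavg_ind_overflow_le`). Since m ≤ 3 * q, a capacity of about 6 * n / w + K is O(n * K /
q). When q < K + 5, q full copies of the database suffice.

Hall's condition only gives existence, while the client needs a small circuit. The matching is found
by an auction with integer prices: an unmatched item in a terminal state would produce a strictly
decreasing chain of item sets longer than the query (`Auction.Valid.complete`). Bounded prices limit
the number of effective bids, and owners and unary prices are updated by polynomial circuits
(`Auction.hasCircuit_run`).

For privacy, fix the hash functions: two queries then differ only in the positions read. Positions
are changed one bucket at a time. Each change is a single-query attack in which all other buckets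
are hard-wired constants, costing no gates (`abs_sub_update_le`), so the advantage grows only by the
number of buckets. -/

/-! ### Composition of Boolean circuits -/

section Circuits

variable {X Y ι ι' κ κ' : Type*}

theorem IsWire.mono {inp : ι → X → Bool} {L L' : List (X → Bool)} (h : L ⊆ L') {g : X → Bool}
    (hg : IsWire inp L g) : IsWire inp L' g := by
  rcases hg with hg | hg | hg
  · exact Or.inl hg
  · exact Or.inr (Or.inl hg)
  · exact Or.inr (Or.inr (h hg))

theorem IsWire.subst {inp : ι → X → Bool} {inp' : ι' → Y → Bool} {φ : Y → X}
    {L₀ : List (Y → Bool)} (hw : ∀ i, IsWire inp' L₀ (fun y => inp i (φ y)))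
    {L : List (X → Bool)} {g : X → Bool} (hg : IsWire inp L g) :
    IsWire inp' (L.map (fun h y => h (φ y)) ++ L₀) (fun y => g (φ y)) := by
  rcases hg with ⟨i, rfl⟩ | ⟨v, rfl⟩ | hg
  · exact (hw i).mono (List.subset_append_right _ _)
  · exact Or.inr (Or.inl ⟨v, rfl⟩)
  · exact Or.inr (Or.inr (List.mem_append_left _ (List.mem_map.2 ⟨g, hg, rfl⟩)))

/-- Gates are recorded as Boolean functions, so plugging one circuit into another is precomposition
with `φ`, stacked on the gates `L₀` that produce the substituted inputs. -/
theorem IsCircuit.subst {inp : ι → X → Bool} {inp' : ι' → Y → Bool} {φ : Y → X}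
    {L₀ : List (Y → Bool)} (h₀ : IsCircuit inp' L₀)
    (hw : ∀ i, IsWire inp' L₀ (fun y => inp i (φ y)))
    {L : List (X → Bool)} (hL : IsCircuit inp L) :
    IsCircuit inp' (L.map (fun h y => h (φ y)) ++ L₀) := by
  induction hL with
  | nil => simpa using h₀
  | gate _ hg hh ih => exact IsCircuit.gate ih (hg.subst hw) (hh.subst hw)

theorem HasCircuit.mono {T T' : ℕ} (h : T ≤ T') {inp : ι → X → Bool} {out : κ → X → Bool}
    (hc : HasCircuit T inp out) : HasCircuit T' inp out := by
  obtain ⟨L, h1, h2, h3⟩ := hc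
  exact ⟨L, h1, h2.trans h, h3⟩

/-- Feed the outputs of a circuit into the inputs of another. -/
theorem HasCircuit.subst {inp : ι → X → Bool} {inp' : ι' → Y → Bool} (φ : Y → X) {T₁ T₂ : ℕ}
    {out : κ → X → Bool} (h₁ : HasCircuit T₁ inp' (fun i y => inp i (φ y)))
    (h₂ : HasCircuit T₂ inp out) : HasCircuit (T₁ + T₂) inp' (fun o y => out o (φ y)) := by
  obtain ⟨L₁, c₁, l₁, w₁⟩ := h₁
  obtain ⟨L₂, c₂, l₂, w₂⟩ := h₂
  refine ⟨_, c₁.subst w₁ c₂, ?_, fun o => (w₂ o).subst w₁⟩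
  simp only [List.length_append, List.length_map]
  omega

theorem HasCircuit.of_wires {inp : ι → X → Bool} {out : κ → X → Bool}
    (h : ∀ o, IsWire inp [] (out o)) : HasCircuit 0 inp out :=
  ⟨[], IsCircuit.nil, le_rfl, h⟩

theorem HasCircuit.reindex {T : ℕ} {inp : ι → X → Bool} {out : κ → X → Bool}
    (h : HasCircuit T inp out) (e : κ' → κ) : HasCircuit T inp (fun o => out (e o)) := by
  obtain ⟨L, h1, h2, h3⟩ := h
  exact ⟨L, h1, h2, fun o => h3 (e o)⟩

theorem HasCircuit.with_inputs {T : ℕ} {inp : ι → X → Bool} {out : κ → X → Bool}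
    (h : HasCircuit T inp out) : HasCircuit T inp (Sum.elim inp out) := by
  obtain ⟨L, h1, h2, h3⟩ := h
  refine ⟨L, h1, h2, ?_⟩
  rintro (i | o)
  · exact Or.inl ⟨i, rfl⟩
  · exact h3 o

/-- Sequential composition in which the second circuit also sees the inputs. -/
theorem HasCircuit.comp {T₁ T₂ : ℕ} {inp : ι → X → Bool} {mid : κ → X → Bool}
    {out : κ' → X → Bool} (h₁ : HasCircuit T₁ inp mid)
    (h₂ : HasCircuit T₂ (Sum.elim inp mid) out) : HasCircuit (T₁ + T₂) inp out :=
  HasCircuit.subst (inp := Sum.elim inp mid) (inp' := inp) id h₁.with_inputs h₂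

/-- Parallel composition of finitely many circuits. -/
theorem HasCircuit.sigma {A : Type*} [Fintype A] {κ : A → Type*} {T : A → ℕ}
    {inp : ι → X → Bool} {out : (a : A) → κ a → X → Bool}
    (h : ∀ a, HasCircuit (T a) inp (out a)) :
    HasCircuit (∑ a, T a) inp (fun o : Σ a, κ a => out o.1 o.2) := by
  classical
  have key : ∀ s : Finset A, ∃ L : List (X → Bool), IsCircuit inp L ∧ L.length ≤ ∑ a ∈ s, T a ∧
      ∀ a ∈ s, ∀ o, IsWire inp L (out a o) := by
    intro s
    induction s using Finset.induction_on with
    | empty => exact ⟨[], IsCircuit.nil, by simp, by simp⟩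
    | insert a s ha ih =>
      obtain ⟨L, c, l, w⟩ := ih
      obtain ⟨L', c', l', w'⟩ := h a
      have hw : ∀ i, IsWire inp L (fun y => inp i (id y)) := fun i => Or.inl ⟨i, rfl⟩
      refine ⟨_, c.subst hw c', ?_, ?_⟩
      · rw [Finset.sum_insert ha]
        simp only [List.length_append, List.length_map]
        omega
      · intro b hb o
        rcases Finset.mem_insert.1 hb with rfl | hb
        · exact (w' o).subst hw
        · exact (w b hb o).mono (List.subset_append_right _ _)
  obtain ⟨L, c, l, w⟩ := key Finset.univ
  exact ⟨L, c, l, fun o => w o.1 (Finset.mem_univ _) o.2⟩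

/-- A circuit with at most `T` gates decides the predicate `p`. -/
def CircuitDecides (T : ℕ) (inp : ι → X → Bool) (p : X → Prop) : Prop :=
  ∃ g : X → Bool, (∀ x, g x = true ↔ p x) ∧ HasCircuit T inp (fun _ : Unit => g)

namespace CircuitDecides

variable {inp : ι → X → Bool} {p p' : X → Prop} {T T' : ℕ}

theorem mono (h : CircuitDecides T inp p) (hT : T ≤ T') : CircuitDecides T' inp p := by
  obtain ⟨g, h1, h2⟩ := h
  exact ⟨g, h1, h2.mono hT⟩

theorem congr (h : CircuitDecides T inp p) (hp : ∀ x, p x ↔ p' x) : CircuitDecides T inp p' := by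
  obtain ⟨g, h1, h2⟩ := h
  exact ⟨g, fun x => (h1 x).trans (hp x), h2⟩

theorem const (P : Prop) : CircuitDecides T inp (fun _ => P) := by
  classical
  exact ⟨fun _ => decide P, by simp,
    (HasCircuit.of_wires fun _ => Or.inr (Or.inl ⟨decide P, rfl⟩)).mono (Nat.zero_le _)⟩

theorem input (i : ι) (hp : ∀ x, inp i x = true ↔ p x) : CircuitDecides T inp p :=
  ⟨inp i, hp, (HasCircuit.of_wires fun _ => Or.inl ⟨i, rfl⟩).mono (Nat.zero_le _)⟩

theorem nand (h : CircuitDecides T inp p) (h' : CircuitDecides T' inp p') :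
    CircuitDecides (T + T' + 1) inp (fun x => ¬ (p x ∧ p' x)) := by
  obtain ⟨g, e, L, c, l, w⟩ := h
  obtain ⟨g', e', L', c', l', w'⟩ := h'
  have hw : ∀ i, IsWire inp L (fun y => inp i (id y)) := fun i => Or.inl ⟨i, rfl⟩
  refine ⟨fun x => !(g x && g' x), fun x => ?_, _,
    IsCircuit.gate (c.subst hw c') ((w ()).mono (List.subset_append_right _ _))
      ((w' ()).subst hw), ?_, fun _ => Or.inr (Or.inr (by simp))⟩
  · have h1 := e x
    have h2 := e' x
    cases hg : g x <;> cases hg' : g' x <;> simp_all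
  · simp only [List.length_cons, List.length_append, List.length_map]
    omega

theorem not (h : CircuitDecides T inp p) : CircuitDecides (T + 1) inp (fun x => ¬ p x) :=
  ((h.nand (const (T := 0) True)).mono (by omega)).congr (by simp)

theorem and (h : CircuitDecides T inp p) (h' : CircuitDecides T' inp p') :
    CircuitDecides (T + T' + 2) inp (fun x => p x ∧ p' x) :=
  ((h.nand h').not).congr (by simp)

theorem or (h : CircuitDecides T inp p) (h' : CircuitDecides T' inp p') :
    CircuitDecides (T + T' + 3) inp (fun x => p x ∨ p' x) :=
  ((h.not.nand h'.not).mono (by omega)).congr (fun x => by tauto)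

theorem all {A : Type*} [Fintype A] {p : A → X → Prop} (h : ∀ a, CircuitDecides T inp (p a)) :
    CircuitDecides (Fintype.card A * (T + 2)) inp (fun x => ∀ a, p a x) := by
  classical
  have key : ∀ s : Finset A, CircuitDecides (s.card * (T + 2)) inp (fun x => ∀ a ∈ s, p a x) := by
    intro s
    induction s using Finset.induction_on with
    | empty => exact (const True).congr (by simp)
    | insert a s ha ih =>
      rw [Finset.card_insert_of_notMem ha]
      exact (((h a).and ih).mono (by ring_nf; omega)).congr (by simp)
  exact (key Finset.univ).congr (by simp)

theorem ex {A : Type*} [Fintype A] {p : A → X → Prop} (h : ∀ a, CircuitDecides T inp (p a)) :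
    CircuitDecides (Fintype.card A * (T + 3) + 1) inp (fun x => ∃ a, p a x) :=
  ((all fun a => (h a).not).not).congr (by simp)

theorem of_hasCircuit {out : κ → X → Bool} (h : HasCircuit T inp out) (o : κ) :
    CircuitDecides T inp (fun x => out o x = true) :=
  ⟨out o, fun _ => Iff.rfl, h.reindex fun _ => o⟩

theorem hasCircuit [Fintype κ] {out : κ → X → Bool}
    (h : ∀ o, CircuitDecides T inp (fun x => out o x = true)) :
    HasCircuit (Fintype.card κ * T) inp out := by
  have : ∀ o, HasCircuit T inp (fun _ : Unit => out o) := by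
    intro o
    obtain ⟨g, h1, h2⟩ := h o
    have : g = out o := funext fun x => Bool.eq_iff_iff.2 (h1 x)
    rwa [this] at h2
  have := (HasCircuit.sigma this).reindex fun o : κ => (⟨o, ()⟩ : Σ _ : κ, Unit)
  simpa using this

theorem subst {inp' : ι' → Y → Bool} (φ : Y → X)
    (h₁ : HasCircuit T inp' (fun i y => inp i (φ y))) (h₂ : CircuitDecides T' inp p) :
    CircuitDecides (T + T') inp' (fun y => p (φ y)) := by
  obtain ⟨g, h1, h2⟩ := h₂
  exact ⟨fun y => g (φ y), fun y => h1 (φ y), HasCircuit.subst φ h₁ h2⟩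

end CircuitDecides

/-! The same operations for circuits whose size is bounded by a power of a fixed base `b`. -/

namespace CircuitDecides

variable {inp : ι → X → Bool} {p p' : X → Prop} {b e c : ℕ}

theorem pow_mono (hb : 8 ≤ b) {e' : ℕ} (he : e ≤ e') (h : CircuitDecides (b ^ e) inp p) :
    CircuitDecides (b ^ e') inp p :=
  h.mono (Nat.pow_le_pow_right (by omega) he)

/-- The large base absorbs additive constants: a connective costs one unit of exponent, and a
quantifier over at most b ^ c indices costs c + 1. -/
theorem pow_not (hb : 8 ≤ b) (h : CircuitDecides (b ^ e) inp p) :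
    CircuitDecides (b ^ (e + 1)) inp (fun x => ¬ p x) := by
  refine h.not.mono ?_
  have : 1 ≤ b ^ e := Nat.one_le_pow _ _ (by omega)
  rw [pow_succ]
  nlinarith

theorem pow_and (hb : 8 ≤ b) (h : CircuitDecides (b ^ e) inp p)
    (h' : CircuitDecides (b ^ e) inp p') :
    CircuitDecides (b ^ (e + 1)) inp (fun x => p x ∧ p' x) := by
  refine (h.and h').mono ?_
  have : 1 ≤ b ^ e := Nat.one_le_pow _ _ (by omega)
  rw [pow_succ]
  nlinarith

theorem pow_or (hb : 8 ≤ b) (h : CircuitDecides (b ^ e) inp p)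
    (h' : CircuitDecides (b ^ e) inp p') :
    CircuitDecides (b ^ (e + 1)) inp (fun x => p x ∨ p' x) := by
  refine (h.or h').mono ?_
  have : 1 ≤ b ^ e := Nat.one_le_pow _ _ (by omega)
  rw [pow_succ]
  nlinarith

theorem pow_all (hb : 8 ≤ b) {A : Type*} [Fintype A] (hA : Fintype.card A ≤ b ^ c)
    {p : A → X → Prop} (h : ∀ a, CircuitDecides (b ^ e) inp (p a)) :
    CircuitDecides (b ^ (e + c + 1)) inp (fun x => ∀ a, p a x) := by
  refine (all h).mono ?_
  have h1 : 1 ≤ b ^ e := Nat.one_le_pow _ _ (by omega)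
  calc Fintype.card A * (b ^ e + 2) ≤ b ^ c * (b ^ e * b) :=
        Nat.mul_le_mul hA (by nlinarith)
    _ = b ^ (e + c + 1) := by ring

theorem pow_ex (hb : 8 ≤ b) {A : Type*} [Fintype A] (hA : Fintype.card A ≤ b ^ c)
    {p : A → X → Prop} (h : ∀ a, CircuitDecides (b ^ e) inp (p a)) :
    CircuitDecides (b ^ (e + c + 1)) inp (fun x => ∃ a, p a x) := by
  refine (ex h).mono ?_
  have h1 : 1 ≤ b ^ e := Nat.one_le_pow _ _ (by omega)
  have h2 : 1 ≤ b ^ c := Nat.one_le_pow _ _ (by omega)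
  calc Fintype.card A * (b ^ e + 3) + 1 ≤ b ^ c * (b ^ e + 3) + b ^ c :=
        Nat.add_le_add (Nat.mul_le_mul_right _ hA) h2
    _ = b ^ c * (b ^ e + 4) := by ring
    _ ≤ b ^ c * (b ^ e * b) := Nat.mul_le_mul_left _ (by nlinarith)
    _ = b ^ (e + c + 1) := by ring

theorem pow_hasCircuit [Fintype κ] (hκ : Fintype.card κ ≤ b ^ c) {out : κ → X → Bool}
    (h : ∀ o, CircuitDecides (b ^ e) inp (fun x => out o x = true)) :
    HasCircuit (b ^ (e + c)) inp out := by
  refine (hasCircuit h).mono ?_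
  rw [pow_add, mul_comm]
  exact Nat.mul_le_mul_left _ hκ

end CircuitDecides

/-- The states reached after `τ` steps, each of which has a circuit with at most `T` gates. -/
theorem HasCircuit.iterate {T T₀ : ℕ} {inp : ι → X → Bool} {σ : ℕ → κ → X → Bool}
    (h₀ : HasCircuit T₀ inp (σ 0)) (τ : ℕ)
    (h : ∀ t < τ, HasCircuit T (Sum.elim inp (σ t)) (σ (t + 1))) :
    HasCircuit (T₀ + τ * T) inp (σ τ) := by
  induction τ with
  | zero => simpa using h₀
  | succ t ih =>
    exact ((ih fun t' ht' => h t' (by omega)).comp (h t (by omega))).mono (by ring_nf; omega)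

end Circuits

/-! ### Bipartite matching by an auction

Unmatched items bid for a cheapest adjacent bucket, which evicts its owner and raises its price. -/

namespace Auction

variable {I U : Type*}

structure State (I U : Type*) where
  owner : U → Option I
  price : U → ℕ

/-- In state `st`, item `x` may bid for the bucket `u`; prices never exceed `L`. -/
def Bid (adj : I → U → Prop) (Q : Finset I) (L : ℕ) (st : State I U) (x : I) (u : U) : Prop :=
  x ∈ Q ∧ adj x u ∧ (∀ v, st.owner v ≠ some x) ∧ st.price u < L ∧
    ∀ v, adj x v → st.price u ≤ st.price v

open Classical in
noncomputable def step (adj : I → U → Prop) (Q : Finset I) (L : ℕ) (st : State I U) (a : I × U) :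
    State I U :=
  if Bid adj Q L st a.1 a.2 then
    ⟨Function.update st.owner a.2 (some a.1), Function.update st.price a.2 (st.price a.2 + 1)⟩
  else st

variable (adj : I → U → Prop) (Q : Finset I) (L : ℕ)

/-- The invariant of the auction. `price_le_succ` is approximate complementary slackness: an item
owns a bucket that was cheapest for it just before its own bid, and other prices have only risen
since. -/
structure Valid (st : State I U) : Prop where
  adj_of_owner : ∀ u x, st.owner u = some x → x ∈ Q ∧ adj x u
  owner_inj : ∀ u v x, st.owner u = some x → st.owner v = some x → u = v
  owned_of_price : ∀ u, 0 < st.price u → ∃ x, st.owner u = some x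
  price_le_succ : ∀ u x, st.owner u = some x → ∀ v, adj x v → st.price u ≤ st.price v + 1
  price_le : ∀ u, st.price u ≤ L

variable {adj Q L}

theorem Valid.step {st : State I U} (h : Valid adj Q L st) (a : I × U) :
    Valid adj Q L (step adj Q L st a) := by
  classical
  unfold Auction.step
  split_ifs with hb
  · obtain ⟨x, u⟩ := a
    obtain ⟨h1, h2, h3, h4, h5⟩ := hb
    simp only at h1 h2 h3 h4 h5
    have hmono : ∀ v, st.price v ≤ Function.update st.price u (st.price u + 1) v := by
      intro v
      by_cases hv : v = u
      · subst hv; simp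
      · simp [hv]
    refine ⟨?_, ?_, ?_, ?_, ?_⟩
    · intro v y
      by_cases hv : v = u
      · subst hv
        simp only [Function.update_self, Option.some.injEq]
        rintro rfl
        exact ⟨h1, h2⟩
      · simpa [hv] using h.adj_of_owner v y
    · intro v v' y hy hy'
      by_cases hv : v = u <;> by_cases hv' : v' = u
      · rw [hv, hv']
      · subst hv
        simp [hv'] at hy hy'
        subst hy
        exact absurd hy' (h3 v')
      · subst hv'
        simp [hv] at hy hy'
        subst hy'
        exact absurd hy (h3 v)
      · simp [hv, hv'] at hy hy'
        exact h.owner_inj v v' y hy hy'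
    · intro v
      by_cases hv : v = u
      · subst hv; simp
      · simpa [hv] using h.owned_of_price v
    · intro v y hy v' hv'
      by_cases hv : v = u
      · subst hv
        simp at hy ⊢
        subst hy
        exact (h5 v' hv').trans (hmono v')
      · simp [hv] at hy ⊢
        exact (h.price_le_succ v y hy v' hv').trans (Nat.succ_le_succ (hmono v'))
    · intro v
      by_cases hv : v = u
      · subst hv; simpa using h4
      · simpa [hv] using h.price_le v
  · exact h

theorem Valid.foldl (l : List (I × U)) {st : State I U} (h : Valid adj Q L st) :
    Valid adj Q L (l.foldl (Auction.step adj Q L) st) := by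
  induction l generalizing st with
  | nil => exact h
  | cons a l ih => exact ih (h.step a)

theorem valid_init : Valid adj Q L (⟨fun _ => none, fun _ => 0⟩ : State I U) :=
  ⟨by simp, by simp, by simp, by simp, by simp⟩

theorem foldl_of_not_bid (l : List (I × U)) {st : State I U}
    (h : ∀ a : I × U, ¬ Bid adj Q L st a.1 a.2) : l.foldl (step adj Q L) st = st := by
  induction l with
  | nil => rfl
  | cons a l ih =>
    have hst : step adj Q L st a = st := if_neg (h a)
    rw [List.foldl_cons, hst, ih]

variable (adj Q L)

/-- The state after going through the list `l` of candidate bids `r` times. -/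
noncomputable def run (l : List (I × U)) (r : ℕ) : State I U :=
  (fun st => l.foldl (step adj Q L) st)^[r] ⟨fun _ => none, fun _ => 0⟩

variable {adj Q L}

theorem valid_run (l : List (I × U)) (r : ℕ) : Valid adj Q L (run adj Q L l r) := by
  induction r with
  | zero => exact valid_init
  | succ r ih =>
    rw [run, Function.iterate_succ_apply']
    exact ih.foldl l

variable [Fintype U]

theorem sum_price_step (st : State I U) (a : I × U) :
    ∑ u, st.price u ≤ ∑ u, (step adj Q L st a).price u := by
  classical
  refine Finset.sum_le_sum fun v _ => ?_
  unfold step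
  split_ifs
  · by_cases hv : v = a.2
    · subst hv; simp
    · simp [hv]
  · exact le_rfl

theorem sum_price_step_of_bid {st : State I U} {a : I × U} (h : Bid adj Q L st a.1 a.2) :
    ∑ u, st.price u < ∑ u, (step adj Q L st a).price u := by
  classical
  refine Finset.sum_lt_sum (fun v _ => ?_) ⟨a.2, Finset.mem_univ _, ?_⟩
  · unfold step
    rw [if_pos h]
    by_cases hv : v = a.2
    · subst hv; simp
    · simp [hv]
  · unfold step
    rw [if_pos h]
    simp

theorem sum_price_foldl (l : List (I × U)) (st : State I U) :
    ∑ u, st.price u ≤ ∑ u, (l.foldl (step adj Q L) st).price u := by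
  induction l generalizing st with
  | nil => exact le_rfl
  | cons a l ih => exact (sum_price_step st a).trans (ih _)

theorem sum_price_foldl_of_bid (l : List (I × U)) {st : State I U}
    (h : ∃ a ∈ l, Bid adj Q L st a.1 a.2) :
    ∑ u, st.price u < ∑ u, (l.foldl (step adj Q L) st).price u := by
  induction l generalizing st with
  | nil => simp at h
  | cons a l ih =>
    by_cases ha : Bid adj Q L st a.1 a.2
    · exact (sum_price_step_of_bid ha).trans_le (sum_price_foldl l _)
    · rw [List.foldl_cons]
      have hst : step adj Q L st a = st := if_neg ha
      rw [hst]
      obtain ⟨a', ha', hb⟩ := h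
      rcases List.mem_cons.1 ha' with rfl | ha'
      · exact absurd hb ha
      · exact ih ⟨a', ha', hb⟩

/-- In a valid state without bids every item is matched, if Hall's condition holds. -/
theorem Valid.complete {st : State I U} (h : Valid adj Q L st) (hL : Q.card < L)
    (hall : ∀ A ⊆ Q, ∀ T : Finset U, (∀ x ∈ A, ∀ u, adj x u → u ∈ T) → A.card ≤ T.card)
    (hb : ∀ x u, ¬ Bid adj Q L st x u) : ∀ x ∈ Q, ∃ u, st.owner u = some x := by
  classical
  by_contra! hx
  obtain ⟨x, hxQ, hx⟩ := hx
  -- the unmatched item sees only buckets of maximal price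
  have hxL : ∀ v, adj x v → L ≤ st.price v := by
    by_contra! hv
    obtain ⟨v, hv, hvL⟩ := hv
    obtain ⟨u, hu, hmin⟩ := (Finset.univ.filter fun v => adj x v).exists_min_image st.price
      ⟨v, by simpa using hv⟩
    simp only [Finset.mem_filter, Finset.mem_univ, true_and] at hu hmin
    exact hb x u ⟨hxQ, hu, hx, (hmin v hv).trans_lt hvL, hmin⟩
  let A : ℕ → Finset I := fun p => Q.filter fun y => ∀ v, adj y v → p ≤ st.price v
  have hxA : ∀ p ≤ L, x ∈ A p := fun p hp =>
    Finset.mem_filter.2 ⟨hxQ, fun v hv => hp.trans (hxL v hv)⟩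
  -- Hall bounds the items of `A (p + 1)` by the buckets of price at least p + 1. These have
  -- distinct owners, which lie in `A p` by slackness and differ from the unmatched x; hence the
  -- strict drop.
  have hstep : ∀ p < L, (A (p + 1)).card + 1 ≤ (A p).card := by
    intro p hp
    let T : Finset U := Finset.univ.filter fun u => p + 1 ≤ st.price u
    have h1 : (A (p + 1)).card ≤ T.card := by
      refine hall _ (Finset.filter_subset _ _) T fun y hy u hyu => ?_
      simpa [T] using (Finset.mem_filter.1 hy).2 u hyu
    have h2 : ∀ u : U, ∃ y, u ∈ T → st.owner u = some y := by
      intro u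
      by_cases hu : u ∈ T
      · obtain ⟨y, hy⟩ := h.owned_of_price u (by simp [T] at hu; omega)
        exact ⟨y, fun _ => hy⟩
      · exact ⟨x, fun h => absurd h hu⟩
    choose o ho using h2
    have h3 : T.card ≤ ((A p).erase x).card := by
      refine Finset.card_le_card_of_injOn o (fun u hu => ?_) fun u hu v hv huv => ?_
      · have hou := ho u hu
        refine Finset.mem_coe.2 (Finset.mem_erase.2 ⟨?_, Finset.mem_filter.2
          ⟨(h.adj_of_owner u _ hou).1, fun v hv => ?_⟩⟩)
        · intro he
          exact hx u (he ▸ hou)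
        · have := h.price_le_succ u _ hou v hv
          have hu' : p + 1 ≤ st.price u := by simpa [T] using hu
          omega
      · have hv' := ho v hv
        rw [← huv] at hv'
        exact h.owner_inj u v _ (ho u hu) hv'
    have h4 := Finset.card_erase_add_one (hxA p hp.le)
    omega
  have hind : ∀ p ≤ L, (A p).card + p ≤ Q.card := by
    intro p
    induction p with
    | zero => intro _; exact Finset.card_filter_le _ _
    | succ p ih =>
      intro hp
      have := hstep p (by omega)
      have := ih (by omega)
      omega
  have := hind L le_rfl
  omega

/-- A pass that starts with an available bid raises the total price, which never exceeds the number
of buckets times L; a pass without one is stationary. So after r passes no bid is left. -/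
theorem run_complete {l : List (I × U)} (hl : ∀ a, a ∈ l) (hL : Q.card < L)
    (hall : ∀ A ⊆ Q, ∀ T : Finset U, (∀ x ∈ A, ∀ u, adj x u → u ∈ T) → A.card ≤ T.card)
    {r : ℕ} (hr : Fintype.card U * L < r) :
    ∀ x ∈ Q, ∃ u, (run adj Q L l r).owner u = some x := by
  refine (valid_run l r).complete hL hall ?_
  by_contra! hb
  have key : ∀ r, (∃ x u, Bid adj Q L (run adj Q L l r) x u) →
      r ≤ ∑ u, (run adj Q L l r).price u := by
    intro r
    induction r with
    | zero => intro _; exact Nat.zero_le _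
    | succ r ih =>
      rw [run, Function.iterate_succ_apply', ← run]
      intro hb
      by_cases hb' : ∃ x u, Bid adj Q L (run adj Q L l r) x u
      · have h1 := ih hb'
        obtain ⟨x, u, hxu⟩ := hb'
        have := sum_price_foldl_of_bid l ⟨(x, u), hl _, hxu⟩
        omega
      · push Not at hb'
        rw [foldl_of_not_bid l fun a => hb' a.1 a.2] at hb
        obtain ⟨x, u, hxu⟩ := hb
        exact absurd hxu (hb' x u)
  have h1 := key r hb
  have h2 : ∑ u, (run adj Q L l r).price u ≤ ∑ _u : U, L :=
    Finset.sum_le_sum fun u _ => (valid_run l r).price_le u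
  simp at h2
  omega

end Auction

/-! ### Circuits for the auction -/

namespace Auction

variable {I U X ι : Type*}

open Classical in
/-- Owners and (unary) prices as Boolean functions of the input. -/
noncomputable def bits (L : ℕ) (st : X → State I U) : (U × I) ⊕ (U × Fin L) → X → Bool :=
  Sum.elim (fun a x => decide ((st x).owner a.1 = some a.2))
    (fun a x => decide (a.2.val < (st x).price a.1))

variable [Fintype U] {adj : X → I → U → Prop} {Q : X → Finset I} {L b : ℕ}
  {inp : ι → X → Bool}

theorem circuitDecides_bid (hb : 8 ≤ b) (hU : Fintype.card U ≤ b) (hL : L ≤ b)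
    (hadj : ∀ y u, ∃ i, ∀ x, inp i x = true ↔ adj x y u)
    (hQ : ∀ y, ∃ i, ∀ x, inp i x = true ↔ y ∈ Q x) (st : X → State I U) (y : I) (u : U) :
    CircuitDecides (b ^ 10) (Sum.elim inp (bits L st))
      (fun x => Bid (adj x) (Q x) L (st x) y u) := by
  have cadj : ∀ v e, CircuitDecides (b ^ e) (Sum.elim inp (bits L st)) (fun x => adj x y v) := by
    intro v e
    obtain ⟨i, hi⟩ := hadj y v
    exact .input (Sum.inl i) hi
  have cQ : ∀ e, CircuitDecides (b ^ e) (Sum.elim inp (bits L st)) (fun x => y ∈ Q x) := by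
    intro e
    obtain ⟨i, hi⟩ := hQ y
    exact .input (Sum.inl i) hi
  have cown : ∀ v e, CircuitDecides (b ^ e) (Sum.elim inp (bits L st))
      (fun x => (st x).owner v = some y) := fun v e =>
    .input (Sum.inr (Sum.inl (v, y))) (by simp [bits])
  have cpr : ∀ v (l : Fin L) e, CircuitDecides (b ^ e) (Sum.elim inp (bits L st))
      (fun x => l.val < (st x).price v) := fun v l e =>
    .input (Sum.inr (Sum.inr (v, l))) (by simp [bits])
  have c1 : CircuitDecides (b ^ 6) (Sum.elim inp (bits L st))
      (fun x => ∀ v, (st x).owner v ≠ some y) :=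
    ((CircuitDecides.pow_all hb (c := 1) (by simpa using hU) fun v =>
      (cown v 0).pow_not hb)).pow_mono hb (by omega)
  have c2 : CircuitDecides (b ^ 6) (Sum.elim inp (bits L st)) (fun x => (st x).price u < L) := by
    rcases Nat.eq_zero_or_pos L with h0 | h0
    · exact (CircuitDecides.const False).congr fun x => by simp [h0]
    · refine (((cpr u ⟨L - 1, by omega⟩ 0).pow_not hb).pow_mono hb (by omega)).congr fun x => ?_
      simp only
      omega
  -- Comparison in unary: a neighbour is cheaper exactly when some level is reached by the price of
  -- u and not by its own.
  have c3 : CircuitDecides (b ^ 6) (Sum.elim inp (bits L st))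
      (fun x => ∀ a : U × Fin L,
        ¬ ((adj x y a.1 ∧ a.2.val < (st x).price u) ∧ ¬ a.2.val < (st x).price a.1)) := by
    refine CircuitDecides.pow_all hb (c := 2) (e := 3) ?_ fun a => ?_
    · rw [Fintype.card_prod, Fintype.card_fin, pow_two]
      exact Nat.mul_le_mul hU hL
    · exact (((cadj a.1 0).pow_and hb (cpr u a.2 0)).pow_and hb
        ((cpr a.1 a.2 0).pow_not hb)).pow_not hb
  refine ((cQ 9).pow_and hb ((cadj u 8).pow_and hb ((c1.pow_mono hb (by omega)).pow_and hb
    (c2.pow_and hb c3)))).congr fun x => ?_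
  unfold Bid
  refine and_congr_right fun _ => and_congr_right fun _ => and_congr_right fun _ =>
    and_congr_right fun hlt => ?_
  constructor
  · intro h v hv
    by_contra! hlt'
    -- The separating level is the price of v; it is below L because the price of u is.
    exact h (v, ⟨(st x).price v, by omega⟩) ⟨⟨hv, hlt'⟩, lt_irrefl _⟩
  · rintro h a ⟨⟨h1, h2⟩, h3⟩
    have := h a.1 h1
    omega

variable [Fintype I]

theorem hasCircuit_step (hb : 8 ≤ b) (hI : Fintype.card I ≤ b) (hU : Fintype.card U ≤ b)
    (hL : L ≤ b) (hadj : ∀ y u, ∃ i, ∀ x, inp i x = true ↔ adj x y u)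
    (hQ : ∀ y, ∃ i, ∀ x, inp i x = true ↔ y ∈ Q x) (st : X → State I U) (a : I × U) :
    HasCircuit (b ^ 16) (Sum.elim inp (bits L st))
      (bits L fun x => step (adj x) (Q x) L (st x) a) := by
  classical
  have cbid := circuitDecides_bid hb hU hL hadj hQ st a.1 a.2
  have cown : ∀ v y e, CircuitDecides (b ^ e) (Sum.elim inp (bits L st))
      (fun x => (st x).owner v = some y) := fun v y e =>
    .input (Sum.inr (Sum.inl (v, y))) (by simp [bits])
  have cpr : ∀ v (l : Fin L) e, CircuitDecides (b ^ e) (Sum.elim inp (bits L st))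
      (fun x => l.val < (st x).price v) := fun v l e =>
    .input (Sum.inr (Sum.inr (v, l))) (by simp [bits])
  refine CircuitDecides.pow_hasCircuit (c := 3) (e := 13) ?_ ?_
  · simp only [Fintype.card_sum, Fintype.card_prod, Fintype.card_fin]
    have h1 := Nat.mul_le_mul hU hI
    have h2 := Nat.mul_le_mul hU hL
    nlinarith [Nat.zero_le (b * b)]
  · rintro (⟨v, y⟩ | ⟨v, l⟩)
    · by_cases hv : v = a.2
      · refine ((cbid.pow_and hb (CircuitDecides.const (a.1 = y))).pow_mono hb
          (Nat.le_succ 11)).pow_or hb ((cbid.pow_not hb).pow_and hb (cown v y 11)) |>.congr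
            fun x => ?_
        by_cases h : Bid (adj x) (Q x) L (st x) a.1 a.2 <;> simp [bits, step, h, hv]
      · refine (cown v y 13).congr fun x => ?_
        by_cases h : Bid (adj x) (Q x) L (st x) a.1 a.2 <;> simp [bits, step, h, hv]
    · by_cases hv : v = a.2
      -- A unary increment shifts levels: level 0 becomes set, and level l copies level l - 1.
      · have cpred : CircuitDecides (b ^ 10) (Sum.elim inp (bits L st))
            (fun x => l.val < (st x).price v + 1) := by
          rcases Nat.eq_zero_or_pos l.val with h0 | h0
          · exact (CircuitDecides.const True).congr fun x => by simp [h0]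
          · refine (cpr v ⟨l.val - 1, by omega⟩ 10).congr fun x => ?_
            simp only
            omega
        refine ((cbid.pow_and hb cpred).pow_mono hb (Nat.le_succ 11)).pow_or hb
          ((cbid.pow_not hb).pow_and hb (cpr v l 11)) |>.congr fun x => ?_
        by_cases h : Bid (adj x) (Q x) L (st x) a.1 a.2 <;> simp [bits, step, h, hv]
      · refine (cpr v l 13).congr fun x => ?_
        by_cases h : Bid (adj x) (Q x) L (st x) a.1 a.2 <;> simp [bits, step, h, hv]

theorem hasCircuit_foldl (hb : 8 ≤ b) (hI : Fintype.card I ≤ b) (hU : Fintype.card U ≤ b)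
    (hL : L ≤ b) (hadj : ∀ y u, ∃ i, ∀ x, inp i x = true ↔ adj x y u)
    (hQ : ∀ y, ∃ i, ∀ x, inp i x = true ↔ y ∈ Q x) (l : List (I × U)) {T : ℕ}
    {st : X → State I U} (h : HasCircuit T inp (bits L st)) :
    HasCircuit (T + l.length * b ^ 16) inp
      (bits L fun x => l.foldl (step (adj x) (Q x) L) (st x)) := by
  induction l generalizing T st with
  | nil => simpa using h
  | cons a l ih =>
    refine (ih (h.comp (hasCircuit_step hb hI hU hL hadj hQ st a))).mono ?_
    rw [List.length_cons]
    ring_nf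
    omega

theorem hasCircuit_run (hb : 8 ≤ b) (hI : Fintype.card I ≤ b) (hU : Fintype.card U ≤ b)
    (hL : L ≤ b) (hadj : ∀ y u, ∃ i, ∀ x, inp i x = true ↔ adj x y u)
    (hQ : ∀ y, ∃ i, ∀ x, inp i x = true ↔ y ∈ Q x) (l : List (I × U)) (r : ℕ) :
    HasCircuit (r * (l.length * b ^ 16)) inp (bits L fun x => run (adj x) (Q x) L l r) := by
  induction r with
  | zero =>
    refine (HasCircuit.of_wires ?_).mono (Nat.zero_le _)
    rintro (a | a) <;> exact Or.inr (Or.inl ⟨false, by simp [bits, run]⟩)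
  | succ r ih =>
    simp only [run, Function.iterate_succ_apply'] at ih ⊢
    exact (hasCircuit_foldl hb hI hU hL hadj hQ l ih).mono (by ring_nf; omega)

theorem circuitDecides_owner (hb : 8 ≤ b) (hI : Fintype.card I ≤ b) (hU : Fintype.card U ≤ b)
    (hL : L ≤ b) (hadj : ∀ y u, ∃ i, ∀ x, inp i x = true ↔ adj x y u)
    (hQ : ∀ y, ∃ i, ∀ x, inp i x = true ↔ y ∈ Q x) (l : List (I × U))
    (hl : l.length ≤ b ^ 2) (r : ℕ) (hr : r ≤ b ^ 3) (u : U) (y : I) :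
    CircuitDecides (b ^ 21) inp (fun x => (run (adj x) (Q x) L l r).owner u = some y) := by
  refine ((CircuitDecides.of_hasCircuit (hasCircuit_run hb hI hU hL hadj hQ l r)
    (Sum.inl (u, y))).mono ?_).congr fun x => by simp [bits]
  calc r * (l.length * b ^ 16) ≤ b ^ 3 * (b ^ 2 * b ^ 16) := by gcongr
    _ = b ^ 21 := by ring

end Auction

/-! ### The code scheduled by the auction, and circuits for the composition -/

namespace CuckooCode

/-- The code with `k` sub-tables of `w` buckets that schedules by an auction. -/
noncomputable def auctionCode (n k w cap : ℕ) (hw : 0 < w) (hcap : 0 < cap) : CuckooCode n where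
  k := k
  w := w
  cap := cap
  w_pos := hw
  cap_pos := hcap
  schedule := fun H Q u =>
    -- The price cap n + 1 exceeds the size of any query, and the number of passes exceeds the
    -- number of buckets times that cap, as `Auction.run_complete` requires.
    (Auction.run (fun x (u : Fin k × Fin w) => H u.1 x = u.2) Q (n + 1)
      (Finset.univ : Finset (Fin n × (Fin k × Fin w))).toList (k * w * (n + 1) + 1)).owner u

variable {n : ℕ} (B : CuckooCode n) {X ι : Type*} {inp : ι → X → Bool} {b : ℕ}

/-- Every bucket keeps a one-hot counter of its members seen so far; scanning the indices in order
updates all counters with a small circuit per step. Stopping at x gives ranks, stopping at n gives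
loads. -/
theorem circuitDecides_card_filter (hb : 8 ≤ b) (hn : n + 1 ≤ b) (hU : B.k * B.w ≤ b)
    {H : X → B.Hash} (hH : ∀ j x v, ∃ i, ∀ X, inp i X = true ↔ H X j x = v)
    (t : ℕ) (ht : t ≤ n) (u : B.Bucket) (c : ℕ) :
    CircuitDecides (b ^ 8) inp
      (fun X => ((B.members (H X) u).filter fun y => y.val < t).card = c) := by
  by_cases hc : n < c
  · refine (CircuitDecides.const False).congr fun X => ?_
    have := ((B.members (H X) u).filter fun y => y.val < t).card_le_univ
    rw [Fintype.card_fin] at this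
    simp only [false_iff]
    omega
  let σ : ℕ → B.Bucket × Fin (n + 1) → X → Bool := fun t a X =>
    decide (((B.members (H X) a.1).filter fun y => y.val < t).card = a.2.val)
  have key : HasCircuit (0 + t * b ^ 7) inp (σ t) := by
    refine HasCircuit.iterate (HasCircuit.of_wires fun a => Or.inr (Or.inl
      ⟨decide (0 = a.2.val), by simp [σ]⟩)) t fun t' ht' => ?_
    refine CircuitDecides.pow_hasCircuit (c := 2) (e := 5) ?_ ?_
    · simp only [Fintype.card_prod, Fintype.card_fin, pow_two]
      exact Nat.mul_le_mul hU hn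
    · rintro ⟨v, d⟩
      have cold : ∀ d' : ℕ, CircuitDecides (b ^ 1) (Sum.elim inp (σ t'))
          (fun X => ((B.members (H X) v).filter fun y => y.val < t').card = d') := by
        intro d'
        by_cases hd : n < d'
        · refine (CircuitDecides.const False).congr fun X => ?_
          have := ((B.members (H X) v).filter fun y => y.val < t').card_le_univ
          rw [Fintype.card_fin] at this
          simp only [false_iff]
          omega
        · exact .input (Sum.inr (v, ⟨d', by omega⟩)) (by simp [σ])
      obtain ⟨i, hi⟩ := hH v.1 ⟨t', by omega⟩ v.2
      have cmem : CircuitDecides (b ^ 1) (Sum.elim inp (σ t'))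
          (fun X => H X v.1 ⟨t', by omega⟩ = v.2) := .input (Sum.inl i) hi
      have cpred : CircuitDecides (b ^ 1) (Sum.elim inp (σ t'))
          (fun X => ((B.members (H X) v).filter fun y => y.val < t').card + 1 = d.val) := by
        rcases Nat.eq_zero_or_pos d.val with h0 | h0
        · exact (CircuitDecides.const False).congr fun X => by simp [h0]
        · refine (cold (d.val - 1)).congr fun X => ?_
          omega
      refine (((cmem.pow_and hb cpred).pow_mono hb (Nat.le_succ 2)).pow_or hb
        ((cmem.pow_not hb).pow_and hb ((cold d.val).pow_mono hb (Nat.le_succ 1)))).pow_mono hb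
          (by omega) |>.congr fun X => ?_
      have hs : ((B.members (H X) v).filter fun y => y.val < t' + 1) =
          if H X v.1 ⟨t', by omega⟩ = v.2 then
            insert ⟨t', by omega⟩ ((B.members (H X) v).filter fun y => y.val < t')
          else ((B.members (H X) v).filter fun y => y.val < t') := by
        ext y
        have hy : y.val = t' ↔ y = ⟨t', by omega⟩ := by rw [Fin.ext_iff]
        split_ifs with hm
        · simp only [members, Finset.mem_filter, Finset.mem_univ, true_and, Finset.mem_insert,
            Nat.lt_succ_iff_lt_or_eq]
          constructor
          · rintro ⟨h1, h2 | h2⟩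
            · exact Or.inr ⟨h1, h2⟩
            · exact Or.inl (hy.1 h2)
          · rintro (h | ⟨h1, h2⟩)
            · subst h
              exact ⟨hm, Or.inr rfl⟩
            · exact ⟨h1, Or.inl h2⟩
        · simp only [members, Finset.mem_filter, Finset.mem_univ, true_and,
            Nat.lt_succ_iff_lt_or_eq]
          constructor
          · rintro ⟨h1, h2 | h2⟩
            · exact ⟨h1, h2⟩
            · rw [hy] at h2
              subst h2
              exact absurd h1 hm
          · rintro ⟨h1, h2⟩
            exact ⟨h1, Or.inl h2⟩
      simp only [σ, decide_eq_true_eq, hs]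
      split_ifs with hm
      · rw [Finset.card_insert_of_notMem (by simp)]
        simp [hm]
      · simp [hm]
  refine ((CircuitDecides.of_hasCircuit key (u, ⟨c, by omega⟩)).mono ?_).congr fun X => by
    simp [σ]
  calc 0 + t * b ^ 7 ≤ b * b ^ 7 := by
        rw [zero_add]
        exact Nat.mul_le_mul_right _ (by omega)
    _ = b ^ 8 := by ring

theorem circuitDecides_rank (hb : 8 ≤ b) (hn : n + 1 ≤ b) (hU : B.k * B.w ≤ b)
    {H : X → B.Hash} (hH : ∀ j x v, ∃ i, ∀ X, inp i X = true ↔ H X j x = v)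
    (u : B.Bucket) (x : Fin n) (c : ℕ) :
    CircuitDecides (b ^ 8) inp (fun X => B.rank (H X) u x = c) :=
  B.circuitDecides_card_filter hb hn hU hH x.val x.isLt.le u c

theorem circuitDecides_card_members (hb : 8 ≤ b) (hn : n + 1 ≤ b) (hU : B.k * B.w ≤ b)
    {H : X → B.Hash} (hH : ∀ j x v, ∃ i, ∀ X, inp i X = true ↔ H X j x = v)
    (u : B.Bucket) (c : ℕ) :
    CircuitDecides (b ^ 8) inp (fun X => (B.members (H X) u).card = c) :=
  (B.circuitDecides_card_filter hb hn hU hH n le_rfl u c).congr fun X => by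
    rw [Finset.filter_true_of_mem fun y _ => y.isLt]

theorem circuitDecides_encode (hb : 8 ≤ b) (hn : n + 1 ≤ b) (hU : B.k * B.w ≤ b)
    {H : X → B.Hash} (hH : ∀ j x v, ∃ i, ∀ X, inp i X = true ↔ H X j x = v) :
    CircuitDecides (b ^ 12) inp (fun X => ∀ u, (B.members (H X) u).card ≤ B.cap) := by
  refine CircuitDecides.pow_all (A := B.Bucket) hb (c := 1) (e := 10) (by simpa using hU)
    fun u => ?_
  refine (CircuitDecides.pow_ex (A := {c : Fin (n + 1) // c.val ≤ B.cap}) hb (c := 1) (e := 8) ?_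
    fun c => B.circuitDecides_card_members hb hn hU hH u c.1.val).congr fun X => ?_
  · rw [pow_one]
    exact (Fintype.card_subtype_le _).trans (by simpa using hn)
  · constructor
    · rintro ⟨c, hc⟩
      exact hc ▸ c.2
    · intro h
      have := (B.members (H X) u).card_le_univ
      rw [Fintype.card_fin] at this
      exact ⟨⟨⟨_, Nat.lt_succ_of_le this⟩, h⟩, rfl⟩

/-- A nonzero position is read only if it is the rank of the scheduled entry. Position 0 is also the
dummy, so it is recognised as the absence of all nonzero positions. -/
theorem circuitDecides_slot (hb : 8 ≤ b) (hn : n + 1 ≤ b) (hU : B.k * B.w ≤ b)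
    (hcap : B.cap ≤ b) {H : X → B.Hash} {Q : X → Finset (Fin n)}
    (hH : ∀ j x v, ∃ i, ∀ X, inp i X = true ↔ H X j x = v)
    (hS : ∀ u x, CircuitDecides (b ^ 21) inp (fun X => B.schedule (H X) (Q X) u = some x))
    (u : B.Bucket) (a : Fin B.cap) :
    CircuitDecides (b ^ 28) inp (fun X => B.slot (H X) (Q X) u = a) := by
  have hpos : ∀ a : Fin B.cap, a.val ≠ 0 →
      CircuitDecides (b ^ 24) inp (fun X => B.slot (H X) (Q X) u = a) := by
    intro a ha
    refine (CircuitDecides.pow_ex (A := Fin n) hb (c := 1) (e := 22) (by simp; omega) fun x =>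
      (hS u x).pow_and hb ((B.circuitDecides_rank hb hn hU hH u x a.val).pow_mono hb
        (by omega))).congr fun X => ?_
    unfold slot
    cases hx : B.schedule (H X) (Q X) u with
    | none =>
      simp only [reduceCtorEq, false_and, exists_false, false_iff]
      exact fun h => ha (by rw [← h])
    | some x =>
      simp only [Option.some.injEq, exists_eq_left']
      split_ifs with h
      · rw [Fin.ext_iff]
      · constructor
        · intro h'
          exact absurd (h' ▸ a.isLt) h
        · exact fun h => absurd (by rw [← h]) ha
  by_cases ha : a.val = 0
  · refine ((CircuitDecides.pow_all (A := {a : Fin B.cap // a.val ≠ 0}) hb (c := 1) (e := 25) ?_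
      fun a' => (hpos a'.1 a'.2).pow_not hb).pow_mono hb (by omega)).congr fun X => ?_
    · rw [pow_one]
      exact (Fintype.card_subtype_le _).trans (by simpa using hcap)
    · constructor
      · intro h
        by_contra hne
        exact h ⟨B.slot (H X) (Q X) u, fun h0 => hne (Fin.ext (h0.trans ha.symm))⟩ rfl
      · intro h a' h'
        exact a'.2 (by rw [← h', h, ha])
  · exact (hpos a ha).pow_mono hb (by omega)

end CuckooCode

theorem HasCircuit.elim_wires {X ι κ κ' : Type*} {T : ℕ} {inp : ι → X → Bool}
    {out : κ → X → Bool} {out' : κ' → X → Bool} (h : HasCircuit T inp out)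
    (h' : ∀ o, IsWire inp [] (out' o)) : HasCircuit T inp (Sum.elim out out') := by
  obtain ⟨L, h1, h2, h3⟩ := h
  refine ⟨L, h1, h2, ?_⟩
  rintro (o | o)
  · exact h3 o
  · exact (h' o).mono (List.nil_subset _)

/-! ### Efficiency, communication and server work of the composed protocol -/

namespace CuckooCode

variable {n : ℕ} (B : CuckooCode n)

/-- Each value of the schedule has a circuit with at most `T` gates, given the hash functions and
the query in unary. -/
def ScheduleWithin (T : ℕ) : Prop :=
  ∀ {X ι : Type} {inp : ι → X → Bool} {H : X → B.Hash} {Q : X → Finset (Fin n)},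
    (∀ j x v, ∃ i, ∀ X, inp i X = true ↔ H X j x = v) →
    (∀ x, ∃ i, ∀ X, inp i X = true ↔ x ∈ Q X) →
    ∀ u x, CircuitDecides T inp (fun X => B.schedule (H X) (Q X) u = some x)

theorem auctionCode_scheduleWithin {n k w cap : ℕ} (hw : 0 < w) (hcap : 0 < cap) {b : ℕ}
    (hb : 8 ≤ b) (hn : n + 1 ≤ b) (hU : k * w ≤ b) (hr : k * w * (n + 1) + 1 ≤ b ^ 3) :
    (auctionCode n k w cap hw hcap).ScheduleWithin (b ^ 21) := by
  intro X ι inp H Q hH hQ u x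
  refine Auction.circuitDecides_owner (I := Fin n) (U := Fin k × Fin w)
    (adj := fun X x u => H X u.1 x = u.2) hb (by simp; omega) (by simpa using hU) hn
    (fun y u => hH u.1 y u.2) hQ _ ?_ _ hr u x
  simp only [Finset.length_toList, Finset.card_univ, Fintype.card_prod, Fintype.card_fin, pow_two]
  exact Nat.mul_le_mul (by omega) hU

/-- The one-hot slot is exactly the unary index that the single-query client takes as input, so its
circuits are attached to the slot circuits bucket by bucket. The exponent 40 is a generous fixed
overhead. -/
theorem efficientWithin_batchPIR {s : ℕ} (P : PIR s B.cap) {b d : ℕ} (hb : 8 ≤ b)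
    (hn : n + 1 ≤ b) (hU : B.k * B.w ≤ b) (hcap : B.cap ≤ b) (hP : P.EfficientWithin (b ^ d))
    (hS : B.ScheduleWithin (b ^ 21)) : (B.batchPIR P).EfficientWithin (b ^ (d + 40)) := by
  obtain ⟨hC, hUp, hDown, hq, hr⟩ := hP
  have h1 : 1 ≤ b := by omega
  have hpow : ∀ {e e' : ℕ}, e ≤ e' → b ^ e ≤ b ^ e' := fun h => Nat.pow_le_pow_right h1 h
  have hbucket : Fintype.card B.Bucket ≤ b ^ 1 := by simpa using hU
  have hprod : ∀ A : Type, [Fintype A] → Fintype.card A ≤ b ^ d →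
      Fintype.card (B.Bucket × A) ≤ b ^ (d + 40) := by
    intro A _ hA
    rw [Fintype.card_prod]
    exact (Nat.mul_le_mul hbucket hA).trans (by rw [← pow_add]; exact hpow (by omega))
  have hslot : ∀ {X ι : Type} {inp : ι → X → Bool} {H : X → B.Hash} {Q : X → Finset (Fin n)},
      (∀ j x v, ∃ i, ∀ X, inp i X = true ↔ H X j x = v) →
      (∀ x, ∃ i, ∀ X, inp i X = true ↔ x ∈ Q X) → ∀ u,
      HasCircuit (b ^ 29) inp (fun (a : Fin B.cap) X => decide (B.slot (H X) (Q X) u = a)) := by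
    intro X ι inp H Q hH hQ u
    refine CircuitDecides.pow_hasCircuit (c := 1) (e := 28) (by simpa using hcap) fun a => ?_
    exact (B.circuitDecides_slot hb hn hU hcap hH (fun u x => hS hH hQ u x) u a).congr
      fun X => by simp
  have hsum : b ^ 29 + b ^ d ≤ b ^ (d + 30) := by
    have h2 : b ^ 29 ≤ b ^ (d + 29) := hpow (by omega)
    have h3 : b ^ d ≤ b ^ (d + 29) := hpow (by omega)
    have h4 : b ^ (d + 30) = b ^ (d + 29) * b := pow_succ _ _
    rw [h4]
    nlinarith
  refine ⟨?_, ?_, hprod _ hC, fun j => hprod _ (hUp j), fun j => hprod _ (hDown j), ?_, ?_, ?_⟩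
  · change Fintype.card (Fin B.k × Fin n × Fin B.w) ≤ _
    simp only [Fintype.card_prod, Fintype.card_fin]
    calc B.k * (n * B.w) = B.k * B.w * n := by ring
      _ ≤ b * b := Nat.mul_le_mul hU (by omega)
      _ = b ^ 2 := (pow_two b).symm
      _ ≤ _ := hpow (by omega)
  · change Fintype.card (B.Bucket × Fin B.cap) ≤ _
    rw [Fintype.card_prod, Fintype.card_fin]
    exact (Nat.mul_le_mul hbucket (hcap.trans (pow_one b).ge)).trans
      (by rw [← pow_add]; exact hpow (by omega))
  · change HasCircuit (X := B.Hash × (Fin n → Bool)) (ι := (Fin B.k × Fin n × Fin B.w) ⊕ Fin n)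
      (κ := Unit ⊕ (B.Bucket × Fin B.cap)) _
      (Sum.elim (fun a x => decide (x.1 a.1 a.2.1 = a.2.2)) (fun a x => x.2 a))
      (Sum.elim (fun _ x => (B.encode x.1 x.2).isSome)
        (fun e x => (B.encode x.1 x.2).getD (fun _ => false) e))
    have hH : ∀ (j : Fin B.k) (x : Fin n) (v : Fin B.w),
        ∃ i, ∀ X : B.Hash × (Fin n → Bool), (Sum.elim (γ := B.Hash × (Fin n → Bool) → Bool)
          (fun (a : Fin B.k × Fin n × Fin B.w) x => decide (x.1 a.1 a.2.1 = a.2.2))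
          (fun (a : Fin n) x => x.2 a)) i X = true ↔ X.1 j x = v :=
      fun j x v => ⟨Sum.inl (j, x, v), fun X => by simp⟩
    have hok := B.circuitDecides_encode hb hn hU hH
    refine (CircuitDecides.pow_hasCircuit (c := 3) (e := 13) ?_ ?_).mono (hpow (by omega))
    · rw [Fintype.card_sum, Fintype.card_unit, Fintype.card_prod, Fintype.card_fin]
      have := Nat.mul_le_mul hbucket (hcap.trans (pow_one b).ge)
      nlinarith [hpow (Nat.zero_le 2)]
    · rintro (_ | ⟨u, c⟩)
      · refine (hok.pow_mono hb (by omega)).congr fun X => ?_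
        simp only [Sum.elim_inl, encode]
        split_ifs with h <;> simpa using h
      · have hbit : CircuitDecides (b ^ 12) (Sum.elim (γ := B.Hash × (Fin n → Bool) → Bool)
            (fun (a : Fin B.k × Fin n × Fin B.w) x => decide (x.1 a.1 a.2.1 = a.2.2))
            (fun (a : Fin n) x => x.2 a))
            (fun X => ∃ x, X.1 u.1 x = u.2 ∧ B.rank X.1 u x = c.val ∧ X.2 x = true) := by
          refine CircuitDecides.pow_ex (A := Fin n) hb (c := 1) (e := 10) (by simp; omega)
            fun x => CircuitDecides.pow_and hb (e := 9) ?_ (CircuitDecides.pow_and hb (e := 8)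
              (B.circuitDecides_rank hb hn hU hH u x c.val) (.input (Sum.inr x) fun X => Iff.rfl))
          obtain ⟨i, hi⟩ := hH u.1 x u.2
          exact .input i hi
        refine (hok.pow_and hb hbit).congr fun X => ?_
        simp only [Sum.elim_inr, encode]
        split_ifs with h
        · exact (and_iff_right h).trans (by simp [members])
        · exact iff_of_false (fun h' => h h'.1) (by simp)
  · change HasCircuit (X := B.Hash × Finset (Fin n) × (B.Bucket × P.Coin → Bool))
      (ι := (Fin B.k × Fin n × Fin B.w) ⊕ (Fin n ⊕ (B.Bucket × P.Coin)))
      (κ := Σ j, B.Bucket × P.Up j) _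
      (Sum.elim (fun a x => decide (x.1 a.1 a.2.1 = a.2.2))
        (Sum.elim (fun a x => decide (a ∈ x.2.1)) (fun r x => x.2.2 r)))
      (fun o x => P.query (B.slot x.1 x.2.1 o.2.1) (fun r => x.2.2 (o.2.1, r)) o.1 o.2.2)
    have hu : ∀ u : B.Bucket, HasCircuit (b ^ 29 + b ^ d)
        (Sum.elim (γ := B.Hash × Finset (Fin n) × (B.Bucket × P.Coin → Bool) → Bool)
          (fun (a : Fin B.k × Fin n × Fin B.w) x => decide (x.1 a.1 a.2.1 = a.2.2))
          (Sum.elim (fun (a : Fin n) x => decide (a ∈ x.2.1))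
            (fun (r : B.Bucket × P.Coin) x => x.2.2 r)))
        (fun (o : Σ j, P.Up j) x =>
          P.query (B.slot x.1 x.2.1 u) (fun r => x.2.2 (u, r)) o.1 o.2) := by
      intro u
      refine HasCircuit.subst (φ := fun x : B.Hash × Finset (Fin n) × (B.Bucket × P.Coin → Bool) =>
        (B.slot x.1 x.2.1 u, fun r => x.2.2 (u, r))) ?_ hq
      have := (hslot (H := fun x : B.Hash × Finset (Fin n) × (B.Bucket × P.Coin → Bool) => x.1)
        (Q := fun x => x.2.1) (inp := Sum.elim
          (fun (a : Fin B.k × Fin n × Fin B.w) x => decide (x.1 a.1 a.2.1 = a.2.2))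
          (Sum.elim (fun (a : Fin n) x => decide (a ∈ x.2.1))
            (fun (r : B.Bucket × P.Coin) x => x.2.2 r)))
        (fun j x v => ⟨Sum.inl (j, x, v), fun X => by simp⟩)
        (fun x => ⟨Sum.inr (Sum.inl x), fun X => by simp⟩) u).elim_wires
        (out' := fun (r : P.Coin) x => x.2.2 (u, r))
        (fun r => Or.inl ⟨Sum.inr (Sum.inr (u, r)), rfl⟩)
      convert this using 1
      funext i
      rcases i with i | i <;> rfl
    refine ((HasCircuit.sigma hu).reindex fun o : Σ j, B.Bucket × P.Up j =>
      (⟨o.2.1, ⟨o.1, o.2.2⟩⟩ : Σ _ : B.Bucket, Σ j, P.Up j)).mono ?_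
    rw [Finset.sum_const, Finset.card_univ, smul_eq_mul]
    exact (Nat.mul_le_mul hbucket hsum).trans (by rw [← pow_add]; exact hpow (by omega))
  · let X := B.Hash × Finset (Fin n) × (B.Bucket × P.Coin → Bool) ×
      ((j : Fin s) → B.Bucket × P.Down j → Bool)
    let inp : (Fin B.k × Fin n × Fin B.w) ⊕ (Fin n ⊕ ((B.Bucket × P.Coin) ⊕
        (Σ j, B.Bucket × P.Down j))) → X → Bool :=
      Sum.elim (fun a x => decide (x.1 a.1 a.2.1 = a.2.2))
        (Sum.elim (fun a x => decide (a ∈ x.2.1)) (Sum.elim (fun r x => x.2.2.1 r)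
          (fun o x => x.2.2.2 o.1 o.2)))
    change HasCircuit _ inp (fun (a : Fin n) x => decide (∃ u, B.schedule x.1 x.2.1 u = some a ∧
      P.recon (B.slot x.1 x.2.1 u) (fun r => x.2.2.1 (u, r)) (fun j e => x.2.2.2 j (u, e)) = true))
    have hH : ∀ j x v, ∃ i, ∀ y : X, inp i y = true ↔ y.1 j x = v :=
      fun j x v => ⟨Sum.inl (j, x, v), fun X => by simp [inp]⟩
    have hQ : ∀ x, ∃ i, ∀ y : X, inp i y = true ↔ x ∈ y.2.1 :=
      fun x => ⟨Sum.inr (Sum.inl x), fun X => by simp [inp]⟩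
    have hu : ∀ u : B.Bucket, CircuitDecides (b ^ 29 + b ^ d) inp (fun x => P.recon
        (B.slot x.1 x.2.1 u) (fun r => x.2.2.1 (u, r)) (fun j e => x.2.2.2 j (u, e)) = true) := by
      intro u
      refine CircuitDecides.subst (φ := fun x : X =>
        (B.slot x.1 x.2.1 u, (fun r => x.2.2.1 (u, r)), (fun j e => x.2.2.2 j (u, e)))) ?_
        (CircuitDecides.of_hasCircuit hr ())
      have := (hslot hH hQ u).elim_wires (out' := Sum.elim (fun (r : P.Coin) (x : X) =>
          x.2.2.1 (u, r)) (fun (o : Σ j, P.Down j) (x : X) => x.2.2.2 o.1 (u, o.2))) (by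
        rintro (r | ⟨j, e⟩)
        · exact Or.inl ⟨Sum.inr (Sum.inr (Sum.inl (u, r))), rfl⟩
        · exact Or.inl ⟨Sum.inr (Sum.inr (Sum.inr ⟨j, u, e⟩)), rfl⟩)
      convert this using 1
      funext i
      rcases i with i | i | i <;> rfl
    refine (CircuitDecides.pow_hasCircuit (c := 1) (e := d + 33) (by simp; omega) fun a => ?_).mono
      (hpow (by omega))
    refine (CircuitDecides.pow_ex (A := B.Bucket) hb hbucket (e := d + 31) fun u =>
      CircuitDecides.pow_and hb ((hS hH hQ u a).pow_mono hb (by omega))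
        ((hu u).mono hsum)).congr fun x => ?_
    simp only [decide_eq_true_eq]

theorem comm_batchPIR {s : ℕ} (P : PIR s B.cap) : (B.batchPIR P).comm = B.k * B.w * P.comm := by
  have : ∀ j, Fintype.card ((B.batchPIR P).Up j) + Fintype.card ((B.batchPIR P).Down j) =
      B.k * B.w * (Fintype.card (P.Up j) + Fintype.card (P.Down j)) := by
    intro j
    change Fintype.card (B.Bucket × P.Up j) + Fintype.card (B.Bucket × P.Down j) = _
    simp only [Fintype.card_prod, Fintype.card_fin]
    ring
  simp only [BatchPIR.comm, PIR.comm, this, Finset.mul_sum]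

/-- The encoded database already consists of the padded buckets: each server runs one copy of its
circuit per bucket, with rewired inputs and no extra gates. -/
theorem serverWork_batchPIR {s : ℕ} (P : PIR s B.cap) {T : ℕ} (h : P.ServerWork T) :
    (B.batchPIR P).ServerWork (B.k * B.w * T) := by
  obtain ⟨size, hsize, hc⟩ := h
  refine ⟨fun j => B.k * B.w * size j, ?_, fun j => ?_⟩
  · rw [← Finset.mul_sum]
    exact Nat.mul_le_mul_left _ hsize
  · change HasCircuit (X := B.Hash × (B.Bucket × Fin B.cap → Bool) × (B.Bucket × P.Up j → Bool))
      (ι := (Fin B.k × Fin n × Fin B.w) ⊕ ((B.Bucket × Fin B.cap) ⊕ (B.Bucket × P.Up j)))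
      (κ := B.Bucket × P.Down j) _
      (Sum.elim (fun a x => decide (x.1 a.1 a.2.1 = a.2.2))
        (Sum.elim (fun e x => x.2.1 e) (fun u x => x.2.2 u)))
      (fun a x => P.answer j (fun i => x.2.1 (a.1, i)) (fun v => x.2.2 (a.1, v)) a.2)
    have hu : ∀ u : B.Bucket, HasCircuit (0 + size j)
        (Sum.elim (γ := B.Hash × (B.Bucket × Fin B.cap → Bool) × (B.Bucket × P.Up j → Bool) → Bool)
          (fun (a : Fin B.k × Fin n × Fin B.w) x => decide (x.1 a.1 a.2.1 = a.2.2))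
          (Sum.elim (fun (e : B.Bucket × Fin B.cap) x => x.2.1 e)
            (fun (u : B.Bucket × P.Up j) x => x.2.2 u)))
        (fun (e : P.Down j) x => P.answer j (fun i => x.2.1 (u, i)) (fun v => x.2.2 (u, v)) e) := by
      intro u
      refine HasCircuit.subst (φ := fun x : B.Hash × (B.Bucket × Fin B.cap → Bool) ×
        (B.Bucket × P.Up j → Bool) => ((fun i => x.2.1 (u, i)), (fun v => x.2.2 (u, v))))
        (HasCircuit.of_wires ?_) (hc j)
      rintro (i | i)
      · exact Or.inl ⟨Sum.inr (Sum.inl (u, i)), rfl⟩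
      · exact Or.inl ⟨Sum.inr (Sum.inr (u, i)), rfl⟩
    refine ((HasCircuit.sigma hu).reindex fun o : B.Bucket × P.Down j =>
      (⟨o.1, o.2⟩ : Σ _ : B.Bucket, P.Down j)).mono ?_
    simp

end CuckooCode

/-! ### Uniform averages -/

section Averages

variable {Ω Ω' : Type*} [Fintype Ω] [Fintype Ω']

theorem ind_nonneg (p : Prop) : 0 ≤ ind p := by
  unfold ind
  split_ifs <;> norm_num

theorem ind_of_true {p : Prop} (h : p) : ind p = 1 := if_pos h

theorem ind_of_false {p : Prop} (h : ¬ p) : ind p = 0 := if_neg h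

theorem uavg_mono {g h : Ω → ℝ} (hgh : ∀ x, g x ≤ h x) : uavg g ≤ uavg h :=
  div_le_div_of_nonneg_right (Finset.sum_le_sum fun x _ => hgh x) (Nat.cast_nonneg _)

theorem uavg_const [Nonempty Ω] (c : ℝ) : uavg (fun _ : Ω => c) = c := by
  have : (Fintype.card Ω : ℝ) ≠ 0 := Nat.cast_ne_zero.2 Fintype.card_ne_zero
  rw [uavg, Finset.sum_const, Finset.card_univ, nsmul_eq_mul]
  field_simp

theorem uavg_sub (g h : Ω → ℝ) : uavg (fun x => g x - h x) = uavg g - uavg h := by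
  simp only [uavg, Finset.sum_sub_distrib, sub_div]

theorem uavg_add (g h : Ω → ℝ) : uavg (fun x => g x + h x) = uavg g + uavg h := by
  simp only [uavg, Finset.sum_add_distrib, add_div]

theorem uavg_sum {A : Type*} (s : Finset A) (g : A → Ω → ℝ) :
    uavg (fun x => ∑ a ∈ s, g a x) = ∑ a ∈ s, uavg (g a) := by
  simp only [uavg, Finset.sum_div]
  exact Finset.sum_comm

theorem abs_uavg_sub_le [Nonempty Ω] {g h : Ω → ℝ} {c : ℝ} (hgh : ∀ x, |g x - h x| ≤ c) :
    |uavg g - uavg h| ≤ c := by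
  rw [← uavg_sub, abs_le]
  constructor
  · rw [← uavg_const (Ω := Ω) (-c)]
    exact uavg_mono fun x => (abs_le.1 (hgh x)).1
  · rw [← uavg_const (Ω := Ω) c]
    exact uavg_mono fun x => (abs_le.1 (hgh x)).2

theorem sum_uniformOfFintype_mul [Nonempty Ω] (g : Ω → ℝ) :
    ∑ p, (PMF.uniformOfFintype Ω p).toReal * g p = uavg g := by
  simp only [PMF.uniformOfFintype_apply, ENNReal.toReal_inv, ENNReal.toReal_natCast, uavg,
    ← Finset.mul_sum]
  rw [div_eq_inv_mul]

open Classical in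
/-- Replace the random bits of the bucket `u`. -/
noncomputable def resample {A C : Type*} (u : A) (ω : A × C → Bool) (y : C → Bool) : A × C → Bool :=
  fun a => if a.1 = u then y a.2 else ω a

/-- Exchanging the bits of bucket u with the fresh bits is an involution of the joint sample space,
hence preserves the uniform measure. -/
theorem uavg_resample {A C : Type*} [Fintype A] [DecidableEq A] [Fintype C] [DecidableEq C] (u : A)
    (g : (A × C → Bool) → ℝ) :
    uavg (fun ω => uavg fun y => g (resample u ω y)) = uavg g := by
  let e : ((A × C → Bool) × (C → Bool)) → ((A × C → Bool) × (C → Bool)) :=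
    fun z => (resample u z.1 z.2, fun r => z.1 (u, r))
  have he : Function.Involutive e := by
    rintro ⟨ω, y⟩
    refine Prod.ext ?_ ?_
    · funext ⟨v, c⟩
      by_cases hv : v = u
      · subst hv; simp [e, resample]
      · simp [e, resample, hv]
    · funext c
      simp [e, resample]
  have hs : ∑ ω, ∑ y, g (resample u ω y) = (Fintype.card (C → Bool) : ℝ) * ∑ ω, g ω := by
    calc ∑ ω, ∑ y, g (resample u ω y) = ∑ z, g (e z).1 := by
          rw [Fintype.sum_prod_type]
      _ = ∑ z : (A × C → Bool) × (C → Bool), g z.1 := 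
          Equiv.sum_comp (he.toPerm e) (fun z : (A × C → Bool) × (C → Bool) => g z.1)
      _ = _ := by
          rw [Fintype.sum_prod_type]
          simp only [Finset.sum_const, Finset.card_univ, nsmul_eq_mul, Finset.mul_sum]
  have hc : (Fintype.card (C → Bool) : ℝ) ≠ 0 := Nat.cast_ne_zero.2 Fintype.card_ne_zero
  simp only [uavg, ← Finset.sum_div, hs]
  field_simp

end Averages

/-! ### Privacy of the composition -/

theorem PIR.PrivateWithin.nonneg {s n sA T : ℕ} {P : PIR s n} {ε : ℝ} (i : Fin n)
    (h : P.PrivateWithin sA T ε) : 0 ≤ ε :=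
  (abs_nonneg _).trans (h 0 (fun _ => ⟨fun _ => false, i, i, ∅, fun _ => false⟩) fun _ =>
    ⟨by simp, (HasCircuit.of_wires fun _ => Or.inr (Or.inl ⟨false, rfl⟩)).mono (Nat.zero_le _)⟩)

namespace CuckooCode

variable {n : ℕ} (B : CuckooCode n) {s : ℕ} (P : PIR s B.cap)

/-- The transcripts of the single-query protocols that read the positions `σ`. -/
def transcriptAt (E : B.Bucket × Fin B.cap → Bool) (σ : B.Bucket → Fin B.cap)
    (ω : B.Bucket × P.Coin → Bool) (j : Fin s) :
    (B.Bucket × P.Up j) ⊕ (B.Bucket × P.Down j) → Bool :=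
  Sum.elim (fun a => P.query (σ a.1) (fun r => ω (a.1, r)) j a.2)
    (fun a => P.answer j (fun i => E (a.1, i)) (P.query (σ a.1) (fun r => ω (a.1, r)) j) a.2)

variable {P}

/-- One hybrid step. Condition on the bits of all other buckets; their transcripts become constants,
and what remains is a single-query attack on bucket u. -/
theorem abs_sub_update_le {sA T : ℕ} {ε : ℝ} (hP : P.PrivateWithin sA T ε) {I : Type}
    (A : Attack s n I (fun j => (B.Bucket × P.Up j) ⊕ (B.Bucket × P.Down j)))
    (hA : A.Admissible sA T) (E : B.Bucket × Fin B.cap → Bool) (σ : B.Bucket → Fin B.cap)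
    (u : B.Bucket) (a : Fin B.cap) :
    |uavg (fun ω => ind (A.guess (B.transcriptAt P E σ ω) = true)) -
      uavg (fun ω => ind (A.guess (B.transcriptAt P E (Function.update σ u a) ω) = true))| ≤ ε := by
  rw [← uavg_resample u, ← uavg_resample u fun ω =>
    ind (A.guess (B.transcriptAt P E (Function.update σ u a) ω) = true)]
  refine abs_uavg_sub_le fun ω => ?_
  -- Completes a transcript of bucket u with the fixed transcripts elsewhere. Its outputs are inputs
  -- or constants, so the size bound T is unchanged.
  let φ : ((j : Fin s) → P.Up j ⊕ P.Down j → Bool) →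
      ((j : Fin s) → (B.Bucket × P.Up j) ⊕ (B.Bucket × P.Down j) → Bool) := fun tr j =>
    Sum.elim (fun b => if b.1 = u then tr j (Sum.inl b.2) else
        B.transcriptAt P E σ ω j (Sum.inl b))
      (fun b => if b.1 = u then tr j (Sum.inr b.2) else
        B.transcriptAt P E σ ω j (Sum.inr b))
  have h := hP 0 (fun _ => ⟨fun i => E (u, i), σ u, a, A.corrupt, fun tr => A.guess (φ tr)⟩)
    fun _ => ⟨hA.1, by
      refine (HasCircuit.subst (T₁ := 0) φ (HasCircuit.of_wires ?_) hA.2).mono (by omega)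
      rintro ⟨j, ⟨v, b⟩ | ⟨v, b⟩⟩
      · by_cases hv : v = u
        · exact Or.inl ⟨⟨j, Sum.inl b⟩, by simp [φ, hv]⟩
        · exact Or.inr (Or.inl ⟨_, by simp only [φ, hv, if_false, Sum.elim_inl]; rfl⟩)
      · by_cases hv : v = u
        · exact Or.inl ⟨⟨j, Sum.inr b⟩, by simp [φ, hv]⟩
        · exact Or.inr (Or.inl ⟨_, by simp only [φ, hv, if_false, Sum.elim_inr]; rfl⟩)⟩
  rw [uavg_const, uavg_const] at h
  have key : ∀ (σ' : B.Bucket → Fin B.cap), (∀ v, v ≠ u → σ' v = σ v) → ∀ y : P.Coin → Bool,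
      B.transcriptAt P E σ' (resample u ω y) = φ (P.transcript (fun i => E (u, i)) (σ' u) y) := by
    intro σ' hσ y
    funext j b
    rcases b with ⟨v, b⟩ | ⟨v, b⟩
    · by_cases hv : v = u
      · subst hv
        simp [φ, transcriptAt, resample, PIR.transcript]
      · simp [φ, transcriptAt, resample, hv, hσ v hv]
    · by_cases hv : v = u
      · subst hv
        simp [φ, transcriptAt, resample, PIR.transcript, PIR.answers]
      · simp [φ, transcriptAt, resample, hv, hσ v hv]
  simp only [PIR.guessProb] at h
  have k0 := fun y => key σ (fun _ _ => rfl) y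
  have k1 := fun y => key (Function.update σ u a) (fun v hv => by simp [hv]) y
  simp only [Function.update_self] at k1
  simp only [k0, k1]
  exact h

/-- Hybrid argument: positions are switched from σ to σ' one bucket at a time, each switch costing
ε. -/
theorem abs_sub_transcriptAt_le {sA T : ℕ} {ε : ℝ} (hP : P.PrivateWithin sA T ε) {I : Type}
    (A : Attack s n I (fun j => (B.Bucket × P.Up j) ⊕ (B.Bucket × P.Down j)))
    (hA : A.Admissible sA T) (E : B.Bucket × Fin B.cap → Bool) (σ σ' : B.Bucket → Fin B.cap) :
    |uavg (fun ω => ind (A.guess (B.transcriptAt P E σ ω) = true)) -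
      uavg (fun ω => ind (A.guess (B.transcriptAt P E σ' ω) = true))| ≤ (B.k * B.w : ℕ) * ε := by
  classical
  have key : ∀ S : Finset B.Bucket,
      |uavg (fun ω => ind (A.guess (B.transcriptAt P E σ ω) = true)) -
        uavg (fun ω => ind (A.guess (B.transcriptAt P E (S.piecewise σ' σ) ω) = true))| ≤
          S.card * ε := by
    intro S
    induction S using Finset.induction_on with
    | empty => simp
    | insert u S hu ih =>
      rw [Finset.piecewise_insert, Finset.card_insert_of_notMem hu]
      have := B.abs_sub_update_le hP A hA E (S.piecewise σ' σ) u (σ' u)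
      refine (abs_sub_le _ _ _).trans ((add_le_add ih this).trans (le_of_eq ?_))
      push_cast
      ring
  have := key Finset.univ
  rwa [Finset.piecewise_univ, Finset.card_univ, Fintype.card_prod, Fintype.card_fin,
    Fintype.card_fin] at this

theorem privateWithin_batchPIR {sA T : ℕ} {ε : ℝ} (hP : P.PrivateWithin sA T ε) (q : ℕ) :
    (B.batchPIR P).PrivateWithin q sA T ((B.k * B.w : ℕ) * ε) := by
  intro r A hA
  have hε : 0 ≤ ε := hP.nonneg ⟨0, B.cap_pos⟩
  refine abs_uavg_sub_le fun ρ => ?_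
  change |(∑ p : B.Hash, (PMF.uniformOfFintype B.Hash p).toReal * _) -
    (∑ p : B.Hash, (PMF.uniformOfFintype B.Hash p).toReal * _)| ≤ _
  rw [sum_uniformOfFintype_mul, sum_uniformOfFintype_mul]
  refine abs_uavg_sub_le fun p => ?_
  unfold BatchPIR.guessProb
  split
  -- Failure to encode depends only on the hash functions and the database, so both sides are 0.
  · simpa using mul_nonneg (Nat.cast_nonneg (B.k * B.w)) hε
  · exact B.abs_sub_transcriptAt_le hP (A ρ p) (hA ρ p).2.2 _ _ _

/-! ### Correctness of the composition -/

theorem rank_lt_rank {H : B.Hash} {u : B.Bucket} {x y : Fin n} (hx : x ∈ B.members H u)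
    (hxy : x < y) : B.rank H u x < B.rank H u y := by
  refine Finset.card_lt_card (Finset.ssubset_iff_of_subset ?_ |>.2 ⟨x, ?_, ?_⟩)
  · intro z hz
    rw [Finset.mem_filter] at hz ⊢
    exact ⟨hz.1, hz.2.trans hxy⟩
  · exact Finset.mem_filter.2 ⟨hx, hxy⟩
  · simp

theorem rank_lt_card {H : B.Hash} {u : B.Bucket} {x : Fin n} (hx : x ∈ B.members H u) :
    B.rank H u x < (B.members H u).card :=
  Finset.card_lt_card (Finset.filter_ssubset.2 ⟨x, hx, lt_irrefl _⟩)

theorem rank_injOn (H : B.Hash) (u : B.Bucket) :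
    Set.InjOn (B.rank H u) (B.members H u : Set (Fin n)) := by
  intro x hx y hy h
  rcases lt_trichotomy x y with hlt | heq | hlt
  · exact absurd h (B.rank_lt_rank hx hlt).ne
  · exact heq
  · exact absurd h (B.rank_lt_rank hy hlt).ne'

/-- Ranks are injective on a bucket, so the position read holds exactly the scheduled entry. Should
an entry be scheduled in several buckets, all return the same bit, and the disjunction in the
reconstruction is harmless. -/
theorem not_errs (hP : P.Correct) {H : B.Hash} {Q : Finset (Fin n)}
    (hcap : ∀ u, (B.members H u).card ≤ B.cap)
    (hmem : ∀ u x, B.schedule H Q u = some x → H u.1 x = u.2)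
    (hall : ∀ x ∈ Q, ∃ u, B.schedule H Q u = some x)
    (ω : B.Bucket × P.Coin → Bool) (db : Fin n → Bool) : ¬ (B.batchPIR P).Errs H ω db Q := by
  have henc : (B.batchPIR P).encode H db = some fun a => decide (∃ x ∈ B.members H a.1,
      B.rank H a.1 x = a.2.val ∧ db x = true) := if_pos hcap
  unfold BatchPIR.Errs
  rw [henc]
  rintro ⟨x, hx, hne⟩
  apply hne
  have hread : ∀ u, B.schedule H Q u = some x → P.recon (B.slot H Q u) (fun r => ω (u, r))
      (P.answers (fun i => decide (∃ y ∈ B.members H u, B.rank H u y = i.val ∧ db y = true))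
        (B.slot H Q u) (fun r => ω (u, r))) = db x := by
    intro u hu
    have hxu : x ∈ B.members H u := by simpa [members] using hmem u x hu
    have hlt : B.rank H u x < B.cap := (B.rank_lt_card hxu).trans_le (hcap u)
    have hslot : B.slot H Q u = ⟨B.rank H u x, hlt⟩ := by
      simp [slot, hu, hlt]
    rw [hP, hslot, Bool.eq_iff_iff, decide_eq_true_eq]
    constructor
    · rintro ⟨y, hy, hr, hdb⟩
      rwa [B.rank_injOn H u hy hxu hr] at hdb
    · exact fun h => ⟨x, hxu, rfl, h⟩
  change decide (∃ u, B.schedule H Q u = some x ∧ P.recon (B.slot H Q u) (fun r => ω (u, r))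
    (P.answers (fun i => decide (∃ y ∈ B.members H u, B.rank H u y = i.val ∧ db y = true))
        (B.slot H Q u) (fun r => ω (u, r))) = true) = db x
  rw [Bool.eq_iff_iff, decide_eq_true_eq]
  constructor
  · rintro ⟨u, hu, h⟩
    rwa [hread u hu] at h
  · intro h
    obtain ⟨u, hu⟩ := hall x hx
    exact ⟨u, hu, (hread u hu).trans h⟩

/-- `Bad` depends on neither the database nor the query, so choosing these after seeing the hash
functions gives no advantage. -/
theorem adversarialError_of_uavg_le {q : ℕ} {ε : ℝ} (Bad : B.Hash → Prop)
    (hBad : uavg (fun H => ind (Bad H)) ≤ ε)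
    (h : ∀ H, ¬ Bad H → ∀ Q : Finset (Fin n), Q.card ≤ q → ∀ (ω : B.Bucket × P.Coin → Bool) db,
      ¬ (B.batchPIR P).Errs H ω db Q) : (B.batchPIR P).AdversarialError q ε := by
  intro r A hA
  rw [← uavg_const (Ω := Fin r → Bool) ε]
  refine uavg_mono fun ρ => ?_
  change (∑ p : B.Hash, (PMF.uniformOfFintype B.Hash p).toReal * _) ≤ _
  rw [sum_uniformOfFintype_mul]
  refine le_trans (uavg_mono fun H => ?_) hBad
  change uavg (fun ω : B.Bucket × P.Coin → Bool => ind ((B.batchPIR P).Errs H ω _ _)) ≤ _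
  rw [← uavg_const (Ω := B.Bucket × P.Coin → Bool) (ind (Bad H))]
  refine uavg_mono fun ω => ?_
  by_cases hH : Bad H
  · rw [ind_of_true hH, ind]
    split_ifs <;> norm_num
  · rw [ind_of_false hH, ind_of_false (h H hH _ (hA ρ H) ω _)]

/-! ### Bad hash functions -/

/-- Some bucket overflows, or some set of at most `q` entries has too few buckets. -/
def Bad {n k w : ℕ} (cap q : ℕ) (H : Fin k → Fin n → Fin w) : Prop :=
  (∃ u : Fin k × Fin w, cap < (Finset.univ.filter fun x => H u.1 x = u.2).card) ∨
    ∃ (S : Finset (Fin n)) (T : Finset (Fin k × Fin w)), S.card ≤ q ∧ T.card < S.card ∧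
      ∀ x ∈ S, ∀ j, (j, H j x) ∈ T

theorem adversarialError_auctionCode {n k w cap q : ℕ} (hw : 0 < w) (hcap : 0 < cap) {ε : ℝ}
    (hBad : uavg (fun H : Fin k → Fin n → Fin w => ind (Bad cap q H)) ≤ ε) {s : ℕ}
    {P : PIR s cap} (hP : P.Correct) :
    ((auctionCode n k w cap hw hcap).batchPIR P).AdversarialError q ε := by
  refine adversarialError_of_uavg_le _ (Bad cap q) hBad fun H hH Q hQ ω db => ?_
  rw [Bad, not_or] at hH
  obtain ⟨h1, h2⟩ := hH
  push Not at h1 h2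
  refine not_errs _ hP h1 (fun u x hux => ?_) (fun x hx => ?_) ω db
  · exact ((Auction.valid_run _ _).adj_of_owner u x hux).2
  · refine Auction.run_complete (fun a => Finset.mem_toList.2 (Finset.mem_univ _))
      (Nat.lt_succ_of_le ?_) (fun A hA T hT => ?_) ?_
      x hx
    · simpa using Q.card_le_univ
    · by_contra! hlt
      obtain ⟨y, hy, j, hj⟩ := h2 A T ((Finset.card_le_card hA).trans hQ) hlt
      exact hj (hT y hy (j, H j y) rfl)
    · rw [Fintype.card_prod, Fintype.card_fin, Fintype.card_fin]
      exact Nat.lt_succ_self _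

end CuckooCode

/-! ### Probability of bad hash functions -/

namespace CuckooCode

/-- Independence of all hash values: the event is a product set, and its density is counted factor
by factor. -/
theorem uavg_ind_forall_mem {n k w : ℕ} [NeZero w] (S : Finset (Fin n))
    (T : Fin k → Finset (Fin w)) :
    uavg (fun H : Fin k → Fin n → Fin w => ind (∀ j, ∀ x ∈ S, H j x ∈ T j)) =
      ∏ j, ((T j).card / w : ℝ) ^ S.card := by
  classical
  have hset : (Finset.univ.filter fun H : Fin k → Fin n → Fin w => ∀ j, ∀ x ∈ S, H j x ∈ T j) =
      Fintype.piFinset fun j => Fintype.piFinset fun x => if x ∈ S then T j else Finset.univ := by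
    ext H
    simp only [Finset.mem_filter, Finset.mem_univ, true_and, Fintype.mem_piFinset]
    refine forall_congr' fun j => forall_congr' fun x => ?_
    split_ifs with hx <;> simp [hx]
  have hsum : ∑ H : Fin k → Fin n → Fin w, ind (∀ j, ∀ x ∈ S, H j x ∈ T j) =
      ∏ j, ∏ x, (if x ∈ S then ((T j).card : ℝ) else w) := by
    have hcount : ∑ H : Fin k → Fin n → Fin w, ind (∀ j, ∀ x ∈ S, H j x ∈ T j) =
        ((Finset.univ.filter fun H : Fin k → Fin n → Fin w =>
          ∀ j, ∀ x ∈ S, H j x ∈ T j).card : ℝ) := by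
      rw [Finset.natCast_card_filter]
      refine Finset.sum_congr rfl fun H _ => ?_
      unfold ind
      congr
    rw [hcount, hset, Fintype.card_piFinset]
    push_cast
    refine Finset.prod_congr rfl fun j _ => ?_
    rw [Fintype.card_piFinset]
    push_cast
    refine Finset.prod_congr rfl fun x _ => ?_
    split_ifs <;> simp
  have hcard : (Fintype.card (Fin k → Fin n → Fin w) : ℝ) = ∏ _j : Fin k, ∏ _x : Fin n, (w : ℝ) := by
    simp
  have hw : (w : ℝ) ≠ 0 := Nat.cast_ne_zero.2 (NeZero.ne w)
  rw [uavg, hsum, hcard, ← Finset.prod_div_distrib]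
  refine Finset.prod_congr rfl fun j _ => ?_
  rw [← Finset.prod_div_distrib, ← Finset.prod_const, ← Finset.prod_subset (Finset.subset_univ S)]
  · refine Finset.prod_congr rfl fun x hx => ?_
    rw [if_pos hx]
  · intro x _ hx
    rw [if_neg hx, div_self hw]

/-- From t ^ t / t! ≤ e ^ t and e < 3. -/
theorem choose_le_pow_div (n t : ℕ) (ht : 1 ≤ t) : (n.choose t : ℝ) ≤ (3 * n / t) ^ t := by
  have h1 : (n.choose t : ℝ) ≤ (n : ℝ) ^ t / (t.factorial : ℝ) := Nat.choose_le_pow_div t n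
  have h2 := Real.pow_div_factorial_le_exp (t : ℝ) (Nat.cast_nonneg t) t
  have h3 : Real.exp t ≤ 3 ^ t := by
    rw [← Real.exp_one_pow]
    exact pow_le_pow_left₀ (Real.exp_pos _).le (Real.exp_one_lt_d9.le.trans (by norm_num)) _
  have ht' : (0 : ℝ) < t := by exact_mod_cast ht
  refine h1.trans ?_
  have h4 : (n : ℝ) ^ t / (t.factorial : ℝ) = (n / t) ^ t * ((t : ℝ) ^ t / t.factorial) := by
    rw [div_pow]
    field_simp
  rw [h4, mul_div_assoc, mul_pow, mul_comm]
  exact mul_le_mul_of_nonneg_right (h2.trans h3) (by positivity)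

/-- AM-GM: after normalising, the factors have mean 1, and x ≤ exp (x - 1) bounds their product by
exp 0. -/
theorem prod_le_mean_pow {k : ℕ} (a : Fin k → ℕ) (w : ℕ) (hw : 0 < w) (hk : 0 < k)
    (ht : 0 < ∑ j, a j) :
    ∏ j, ((a j : ℝ) / w) ≤ (((∑ j, a j : ℕ) : ℝ) / ((k * w : ℕ) : ℝ)) ^ k := by
  set t := ∑ j, a j with htdef
  have ht' : (0 : ℝ) < t := by exact_mod_cast ht
  have hw' : (0 : ℝ) < w := by exact_mod_cast hw
  have hk' : (0 : ℝ) < k := by exact_mod_cast hk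
  have h1 : ∏ j, ((a j : ℝ) * k / t) ≤ 1 := by
    calc ∏ j, ((a j : ℝ) * k / t) ≤ ∏ j, Real.exp ((a j : ℝ) * k / t - 1) :=
          Finset.prod_le_prod (fun j _ => by positivity) fun j _ => by
            have := Real.add_one_le_exp ((a j : ℝ) * k / t - 1)
            linarith
      _ = Real.exp (∑ j, ((a j : ℝ) * k / t - 1)) := (Real.exp_sum _ _).symm
      _ = 1 := by
          rw [Finset.sum_sub_distrib, ← Finset.sum_div, ← Finset.sum_mul, ← Nat.cast_sum, ← htdef]
          simp [ht'.ne', mul_div_cancel_left₀]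
  have h2 : ∀ j, ((a j : ℝ) / w) = ((t : ℝ) / ((k * w : ℕ) : ℝ)) * ((a j : ℝ) * k / t) := by
    intro j
    push_cast
    field_simp
  simp only [h2, Finset.prod_mul_distrib, Finset.prod_const, Finset.card_univ, Fintype.card_fin]
  exact mul_le_of_le_one_right (by positivity) h1

theorem uavg_ind_overflow_le {n k w cap : ℕ} (hw : 0 < w) (hcap : 1 ≤ cap)
    (hload : 6 * n ≤ w * cap) :
    uavg (fun H : Fin k → Fin n → Fin w => ind (∃ u : Fin k × Fin w,
      cap < (Finset.univ.filter fun x => H u.1 x = u.2).card)) ≤ (k * w : ℕ) * (1 / 2 : ℝ) ^ cap := by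
  classical
  have : NeZero w := ⟨hw.ne'⟩
  -- Only the sub-table of u is constrained; the others contribute a factor 1.
  let T : Fin k × Fin w → Fin k → Finset (Fin w) := fun u j =>
    if j = u.1 then {u.2} else Finset.univ
  have hunion : ∀ H : Fin k → Fin n → Fin w, ind (∃ u : Fin k × Fin w,
      cap < (Finset.univ.filter fun x => H u.1 x = u.2).card) ≤
      ∑ u : Fin k × Fin w, ∑ S ∈ Finset.powersetCard cap (Finset.univ : Finset (Fin n)),
        ind (∀ j, ∀ x ∈ S, H j x ∈ T u j) := by
    intro H
    by_cases h : ∃ u : Fin k × Fin w, cap < (Finset.univ.filter fun x => H u.1 x = u.2).card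
    · rw [ind_of_true h]
      obtain ⟨u, hu⟩ := h
      obtain ⟨S, hS, hcard⟩ := Finset.exists_subset_card_eq hu.le
      have hin : ∀ j, ∀ x ∈ S, H j x ∈ T u j := by
        intro j x hx
        simp only [T]
        split_ifs with hj
        · subst hj
          simpa using (Finset.mem_filter.1 (hS hx)).2
        · exact Finset.mem_univ _
      rw [← ind_of_true hin]
      refine le_trans ?_ (Finset.single_le_sum (f := fun u => ∑ S ∈ Finset.powersetCard cap
        (Finset.univ : Finset (Fin n)), ind (∀ j, ∀ x ∈ S, H j x ∈ T u j))
        (fun u _ => Finset.sum_nonneg fun S _ => ind_nonneg _) (Finset.mem_univ u))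
      exact Finset.single_le_sum (f := fun S => ind (∀ j, ∀ x ∈ S, H j x ∈ T u j))
        (fun S _ => ind_nonneg _)
        (Finset.mem_powersetCard.2 ⟨Finset.subset_univ _, hcard⟩)
    · rw [ind_of_false h]
      exact Finset.sum_nonneg fun u _ => Finset.sum_nonneg fun S _ => ind_nonneg _
  refine (uavg_mono hunion).trans ?_
  rw [uavg_sum]
  simp only [uavg_sum, uavg_ind_forall_mem]
  have hw' : (0 : ℝ) < w := by exact_mod_cast hw
  have hcap' : (0 : ℝ) < cap := by exact_mod_cast hcap
  have hterm : ∀ u : Fin k × Fin w, ∏ j, ((T u j).card / w : ℝ) ^ cap = (1 / w) ^ cap := by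
    intro u
    rw [Finset.prod_eq_single u.1]
    · simp [T]
    · intro j _ hj
      simp [T, hj, hw'.ne']
    · simp
  have hinner : ∀ u : Fin k × Fin w,
      ∑ S ∈ Finset.powersetCard cap (Finset.univ : Finset (Fin n)),
        ∏ j, ((T u j).card / w : ℝ) ^ S.card ≤ (1 / 2 : ℝ) ^ cap := by
    intro u
    have : ∀ S ∈ Finset.powersetCard cap (Finset.univ : Finset (Fin n)),
        ∏ j, ((T u j).card / w : ℝ) ^ S.card = (1 / w) ^ cap := by
      intro S hS
      rw [(Finset.mem_powersetCard.1 hS).2, hterm]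
    rw [Finset.sum_congr rfl this, Finset.sum_const, Finset.card_powersetCard, Finset.card_univ,
      Fintype.card_fin, nsmul_eq_mul]
    calc (n.choose cap : ℝ) * (1 / w) ^ cap ≤ (3 * n / cap) ^ cap * (1 / w) ^ cap :=
          mul_le_mul_of_nonneg_right (choose_le_pow_div n cap hcap) (by positivity)
      _ = (3 * n / cap * (1 / w)) ^ cap := (mul_pow _ _ _).symm
      _ ≤ (1 / 2) ^ cap := by
          refine pow_le_pow_left₀ (by positivity) ?_ _
          have : (6 * n : ℝ) ≤ w * cap := by exact_mod_cast hload
          rw [div_mul_div_comm, div_le_div_iff₀ (by positivity) (by norm_num)]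
          nlinarith
  refine (Finset.sum_le_sum fun u _ => hinner u).trans (le_of_eq ?_)
  rw [Finset.sum_const, Finset.card_univ, Fintype.card_prod, Fintype.card_fin, Fintype.card_fin,
    nsmul_eq_mul]

/-- Splitting T by sub-tables turns the probability into a product of densities whose numerators sum
to t; AM-GM says an even split is the worst case. -/
theorem uavg_ind_subset_le {n k w t : ℕ} (hw : 0 < w) (hk : 0 < k) (ht : 1 ≤ t)
    {S : Finset (Fin n)} (hS : S.card = t) {T : Finset (Fin k × Fin w)} (hT : T.card = t) :
    uavg (fun H : Fin k → Fin n → Fin w => ind (∀ x ∈ S, ∀ j, (j, H j x) ∈ T)) ≤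
      ((t : ℝ) / ((k * w : ℕ) : ℝ)) ^ (k * t) := by
  classical
  have : NeZero w := ⟨hw.ne'⟩
  let T' : Fin k → Finset (Fin w) := fun j => Finset.univ.filter fun v => (j, v) ∈ T
  have hcard : ∑ j, (T' j).card = t := by
    rw [← hT, ← Finset.card_sigma]
    refine Finset.card_bij (fun a _ => (a.1, a.2)) ?_ ?_ ?_
    · rintro ⟨j, v⟩ h
      simpa [T'] using h
    · rintro ⟨j, v⟩ _ ⟨j', v'⟩ _ h
      simp only [Prod.mk.injEq] at h
      obtain ⟨rfl, rfl⟩ := h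
      rfl
    · rintro ⟨j, v⟩ h
      exact ⟨⟨j, v⟩, by simpa [T'] using h, rfl⟩
  have hiff : ∀ H : Fin k → Fin n → Fin w,
      (∀ x ∈ S, ∀ j, (j, H j x) ∈ T) ↔ ∀ j, ∀ x ∈ S, H j x ∈ T' j := by
    intro H
    simp only [T', Finset.mem_filter, Finset.mem_univ, true_and]
    exact ⟨fun h j x hx => h x hx j, fun h x hx j => h j x hx⟩
  simp only [hiff]
  rw [uavg_ind_forall_mem, Finset.prod_pow, hS, pow_mul]
  refine pow_le_pow_left₀ (Finset.prod_nonneg fun j _ => by positivity) ?_ _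
  have := prod_le_mean_pow (fun j => (T' j).card) w hw hk (by omega)
  rwa [hcard] at this

theorem uavg_ind_hall_le {n k w q : ℕ} (hw : 0 < w) (hk : 0 < k) (hq : 2 * q ≤ k * w) {ε : ℝ}
    (hε : 0 ≤ ε) (hε1 : ε ≤ 1) (hn : 3 * n * (1 / 2 : ℝ) ^ (k - 1) ≤ ε / 4) :
    uavg (fun H : Fin k → Fin n → Fin w => ind (∃ (S : Finset (Fin n))
      (T : Finset (Fin k × Fin w)), S.card ≤ q ∧ T.card < S.card ∧
        ∀ x ∈ S, ∀ j, (j, H j x) ∈ T)) ≤ ε / 2 := by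
  classical
  have hunion : ∀ H : Fin k → Fin n → Fin w, ind (∃ (S : Finset (Fin n))
      (T : Finset (Fin k × Fin w)), S.card ≤ q ∧ T.card < S.card ∧
        ∀ x ∈ S, ∀ j, (j, H j x) ∈ T) ≤
      ∑ t ∈ Finset.Icc 1 q, ∑ S ∈ Finset.powersetCard t (Finset.univ : Finset (Fin n)),
        ∑ T ∈ Finset.powersetCard t (Finset.univ : Finset (Fin k × Fin w)),
          ind (∀ x ∈ S, ∀ j, (j, H j x) ∈ T) := by
    intro H
    by_cases h : ∃ (S : Finset (Fin n)) (T : Finset (Fin k × Fin w)), S.card ≤ q ∧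
        T.card < S.card ∧ ∀ x ∈ S, ∀ j, (j, H j x) ∈ T
    · rw [ind_of_true h]
      obtain ⟨S, T, hS, hT, hin⟩ := h
      -- Enlarging T to the size of S leaves a single size parameter in the union bound; there is
      -- room, since S has at most q ≤ k * w elements.
      obtain ⟨T', hT', hcard⟩ := Finset.exists_superset_card_eq (s := T) (n := S.card) hT.le
        (by simp; omega)
      have hin' : ∀ x ∈ S, ∀ j, (j, H j x) ∈ T' := fun x hx j => hT' (hin x hx j)
      rw [← ind_of_true hin']
      refine le_trans ?_ (Finset.single_le_sum (f := fun t => ∑ S ∈ Finset.powersetCard t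
        (Finset.univ : Finset (Fin n)), ∑ T ∈ Finset.powersetCard t
          (Finset.univ : Finset (Fin k × Fin w)), ind (∀ x ∈ S, ∀ j, (j, H j x) ∈ T))
        (fun t _ => Finset.sum_nonneg fun S _ => Finset.sum_nonneg fun T _ => ind_nonneg _)
        (Finset.mem_Icc.2 ⟨by omega, hS⟩ : S.card ∈ Finset.Icc 1 q))
      refine le_trans ?_ (Finset.single_le_sum (f := fun S => ∑ T ∈ Finset.powersetCard _
          (Finset.univ : Finset (Fin k × Fin w)), ind (∀ x ∈ S, ∀ j, (j, H j x) ∈ T))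
        (fun S _ => Finset.sum_nonneg fun T _ => ind_nonneg _)
        (Finset.mem_powersetCard.2 ⟨Finset.subset_univ S, rfl⟩))
      exact Finset.single_le_sum (f := fun T => ind (∀ x ∈ S, ∀ j, (j, H j x) ∈ T))
        (fun T _ => ind_nonneg _)
        (Finset.mem_powersetCard.2 ⟨Finset.subset_univ T', hcard⟩)
    · rw [ind_of_false h]
      exact Finset.sum_nonneg fun t _ => Finset.sum_nonneg fun S _ =>
        Finset.sum_nonneg fun T _ => ind_nonneg _
  refine (uavg_mono hunion).trans ?_
  simp only [uavg_sum]
  have hkw : 0 < k * w := Nat.mul_pos hk hw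
  have hm : (0 : ℝ) < ((k * w : ℕ) : ℝ) := by exact_mod_cast hkw
  have hterm : ∀ t ∈ Finset.Icc 1 q,
      ∑ S ∈ Finset.powersetCard t (Finset.univ : Finset (Fin n)),
        ∑ T ∈ Finset.powersetCard t (Finset.univ : Finset (Fin k × Fin w)),
          uavg (fun H : Fin k → Fin n → Fin w => ind (∀ x ∈ S, ∀ j, (j, H j x) ∈ T)) ≤
      ε * (1 / 4 : ℝ) ^ t := by
    intro t ht
    obtain ⟨ht1, htq⟩ := Finset.mem_Icc.1 ht
    have ht' : (0 : ℝ) < t := by exact_mod_cast ht1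
    have hbound : ∀ S ∈ Finset.powersetCard t (Finset.univ : Finset (Fin n)),
        ∑ T ∈ Finset.powersetCard t (Finset.univ : Finset (Fin k × Fin w)),
          uavg (fun H : Fin k → Fin n → Fin w => ind (∀ x ∈ S, ∀ j, (j, H j x) ∈ T)) ≤
        (k * w).choose t * ((t : ℝ) / ((k * w : ℕ) : ℝ)) ^ (k * t) := by
      intro S hS
      refine (Finset.sum_le_card_nsmul _ _ _ fun T hT => uavg_ind_subset_le hw hk ht1
        (Finset.mem_powersetCard.1 hS).2 (Finset.mem_powersetCard.1 hT).2).trans (le_of_eq ?_)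
      rw [Finset.card_powersetCard, nsmul_eq_mul, Finset.card_univ, Fintype.card_prod,
        Fintype.card_fin, Fintype.card_fin]
    refine (Finset.sum_le_card_nsmul _ _ _ hbound).trans ?_
    rw [Finset.card_powersetCard, nsmul_eq_mul, Finset.card_univ, Fintype.card_fin]
    have hc1 : (n.choose t : ℝ) ≤ (n : ℝ) ^ t := by exact_mod_cast Nat.choose_le_pow n t
    have hc2 := choose_le_pow_div (k * w) t ht1
    have hhalf : (t : ℝ) / ((k * w : ℕ) : ℝ) ≤ 1 / 2 := by
      rw [div_le_div_iff₀ hm (by norm_num)]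
      have : t * 2 ≤ 1 * (k * w) := by omega
      exact_mod_cast this
    have hbase : (n : ℝ) * ((3 * ((k * w : ℕ) : ℝ) / t) * ((t : ℝ) / ((k * w : ℕ) : ℝ)) ^ k) ≤
        ε / 4 := by
      have hsplit : ((t : ℝ) / ((k * w : ℕ) : ℝ)) ^ k =
          ((t : ℝ) / ((k * w : ℕ) : ℝ)) ^ (k - 1) * ((t : ℝ) / ((k * w : ℕ) : ℝ)) := by
        rw [← pow_succ, Nat.sub_add_cancel hk]
      have : (n : ℝ) * ((3 * ((k * w : ℕ) : ℝ) / t) * ((t : ℝ) / ((k * w : ℕ) : ℝ)) ^ k) =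
          3 * n * ((t : ℝ) / ((k * w : ℕ) : ℝ)) ^ (k - 1) := by
        rw [hsplit]
        field_simp
      rw [this]
      exact (mul_le_mul_of_nonneg_left (pow_le_pow_left₀ (by positivity) hhalf _)
        (by positivity)).trans hn
    calc (n.choose t : ℝ) * ((k * w).choose t * ((t : ℝ) / ((k * w : ℕ) : ℝ)) ^ (k * t))
        ≤ (n : ℝ) ^ t * ((3 * ((k * w : ℕ) : ℝ) / t) ^ t *
            ((t : ℝ) / ((k * w : ℕ) : ℝ)) ^ (k * t)) := by
          gcongr
      _ = ((n : ℝ) * ((3 * ((k * w : ℕ) : ℝ) / t) *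
            ((t : ℝ) / ((k * w : ℕ) : ℝ)) ^ k)) ^ t := by
          rw [mul_pow, mul_pow, ← pow_mul]
      _ ≤ (ε / 4) ^ t := pow_le_pow_left₀ (by positivity) hbase _
      _ = ε ^ t * (1 / 4) ^ t := by rw [← mul_pow]; ring
      _ ≤ ε * (1 / 4) ^ t := by
          refine mul_le_mul_of_nonneg_right ?_ (by positivity)
          exact pow_le_of_le_one hε hε1 (by omega)
  refine (Finset.sum_le_sum hterm).trans ?_
  rw [← Finset.mul_sum]
  have hgeom : ∀ q : ℕ, ∑ t ∈ Finset.Icc 1 q, (1 / 4 : ℝ) ^ t = (1 - (1 / 4) ^ q) / 3 := by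
    intro q
    induction q with
    | zero => simp
    | succ q ih =>
      rw [Finset.sum_Icc_succ_top (by omega), ih]
      ring
  rw [hgeom]
  have : (0 : ℝ) ≤ (1 / 4) ^ q := by positivity
  nlinarith

/-- The offsets 5 and 4 serve 3 * 2 ^ f * 2 ^ -(f + lam + 4) = (3/16) * 2 ^ -lam. Overflow then
takes at most a quarter of the error budget and Hall violations at most half. -/
theorem uavg_ind_bad_le {n k w cap q f lam : ℕ} (hw : 0 < w) (hk : k = f + lam + 5)
    (hcap : f + lam + 4 ≤ cap) (hload : 6 * n ≤ w * cap) (hq : 2 * q ≤ k * w)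
    (hkw : k * w ≤ 3 * n) (hn : n ≤ 2 ^ f) :
    uavg (fun H : Fin k → Fin n → Fin w => ind (Bad cap q H)) ≤ (1 / 2 : ℝ) ^ lam := by
  set ε : ℝ := (1 / 2) ^ lam with hε
  have hε0 : 0 ≤ ε := by positivity
  have hsmall : 3 * n * (1 / 2 : ℝ) ^ (f + lam + 4) ≤ ε / 4 := by
    have hn' : (n : ℝ) ≤ 2 ^ f := by exact_mod_cast hn
    have h1 : (2 : ℝ) ^ f * (1 / 2) ^ f = 1 := by rw [← mul_pow]; norm_num
    calc 3 * n * (1 / 2 : ℝ) ^ (f + lam + 4)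
        ≤ 3 * 2 ^ f * (1 / 2 : ℝ) ^ (f + lam + 4) := by gcongr
      _ = 3 * ((2 : ℝ) ^ f * (1 / 2) ^ f) * ε * (1 / 2) ^ 4 := by rw [hε]; ring
      _ ≤ ε / 4 := by rw [h1]; linarith
  have h1 := uavg_ind_overflow_le (k := k) (n := n) hw (by omega : 1 ≤ cap) hload
  have h2 : ((k * w : ℕ) : ℝ) * (1 / 2 : ℝ) ^ cap ≤ ε / 4 := by
    refine le_trans ?_ hsmall
    have h3 : ((k * w : ℕ) : ℝ) ≤ 3 * n := by exact_mod_cast hkw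
    exact mul_le_mul h3 (pow_le_pow_of_le_one (by norm_num) (by norm_num) hcap) (by positivity)
      (by positivity)
  have h3 := uavg_ind_hall_le (n := n) hw (by omega : 0 < k) hq hε0
    (pow_le_one₀ (by norm_num) (by norm_num)) (by
      rw [hk]
      exact hsmall)
  refine le_trans (uavg_mono (h := fun H => _ + _) fun H => ?_)
    ((uavg_add _ _).le.trans ((add_le_add h1 h3).trans (by linarith)))
  by_cases ha : ∃ u : Fin k × Fin w, cap < (Finset.univ.filter fun x => H u.1 x = u.2).card
  · rw [ind_of_true ha, ind_of_true (p := Bad cap q H) (Or.inl ha)]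
    linarith [ind_nonneg (∃ (S : Finset (Fin n)) (T : Finset (Fin k × Fin w)),
      S.card ≤ q ∧ T.card < S.card ∧ ∀ x ∈ S, ∀ j, (j, H j x) ∈ T)]
  · rw [ind_of_false ha, zero_add]
    by_cases hb : Bad cap q H
    · rw [ind_of_true hb, ind_of_true (hb.resolve_left ha)]
    · rw [ind_of_false hb]
      exact ind_nonneg _

/-- With one bucket per sub-table every entry lies in all q buckets, so a nonempty set already has q
buckets available, and capacity n cannot overflow. -/
theorem uavg_ind_bad_eq_zero (n q : ℕ) :
    uavg (fun H : Fin q → Fin n → Fin 1 => ind (Bad n q H)) = 0 := by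
  have hnot : ∀ H : Fin q → Fin n → Fin 1, ¬ Bad n q H := by
    rintro H (⟨u, hu⟩ | ⟨S, T, hS, hT, hin⟩)
    · exact absurd ((Finset.card_le_univ _).trans_eq (Fintype.card_fin n)) hu.not_ge
    · obtain ⟨x, hx⟩ := Finset.card_pos.1 (Nat.zero_lt_of_lt hT)
      have hTu : T = Finset.univ := by
        ext ⟨j, v⟩
        simpa [Subsingleton.elim v (H j x)] using hin x hx j
      rw [hTu, Finset.card_univ] at hT
      simp at hT
      omega
  simp only [ind_of_false (hnot _)]
  simp [uavg]

end CuckooCode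

/-! ### Monotonicity in the bounds, choice of parameters, and assembly -/

theorem PIR.EfficientWithin.mono {s n T T' : ℕ} {P : PIR s n} (h : P.EfficientWithin T)
    (hT : T ≤ T') : P.EfficientWithin T' :=
  ⟨h.1.trans hT, fun j => (h.2.1 j).trans hT, fun j => (h.2.2.1 j).trans hT,
    h.2.2.2.1.mono hT, h.2.2.2.2.mono hT⟩

theorem PIR.PrivateWithin.anti {s n sA T T' : ℕ} {P : PIR s n} {ε : ℝ}
    (h : P.PrivateWithin sA T' ε) (hT : T ≤ T') : P.PrivateWithin sA T ε :=
  fun r A hA => h r A fun ρ => ⟨(hA ρ).1, (hA ρ).2.mono hT⟩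

theorem BatchPIR.ServerWork.mono {s n T T' : ℕ} {S : BatchPIR s n} (h : S.ServerWork T)
    (hT : T ≤ T') : S.ServerWork T' := by
  obtain ⟨size, h1, h2⟩ := h
  exact ⟨size, h1.trans hT, h2⟩

namespace CuckooCode

theorem exists_auctionCode {f lam n q : ℕ} (hn : 2 ≤ n) (hf : n ≤ 2 ^ f) (hq : 1 ≤ q)
    (hqn : q ≤ n) : ∃ B : CuckooCode n,
      B.k ≤ 6 * (f + lam) ∧ B.k * B.w ≤ 3 * q ∧ B.cap * q ≤ 23 * (n * (f + lam)) ∧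
      B.cap ≤ 7 * n ∧
      (∀ (s : ℕ) (P : PIR s B.cap), P.Correct →
        (B.batchPIR P).AdversarialError q ((1 / 2 : ℝ) ^ lam)) ∧
      ∀ b : ℕ, 8 ≤ b → n + 1 ≤ b → B.k * B.w ≤ b → B.ScheduleWithin (b ^ 21) := by
  have hf1 : 1 ≤ f := by
    by_contra! h
    interval_cases f
    omega
  have hsched : ∀ {k w cap : ℕ} (hw : 0 < w) (hcap : 0 < cap) (b : ℕ), 8 ≤ b → n + 1 ≤ b →
      k * w ≤ b → (auctionCode n k w cap hw hcap).ScheduleWithin (b ^ 21) := by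
    intro k w cap hw hcap b hb hnb hU
    refine auctionCode_scheduleWithin hw hcap hb hnb hU ?_
    have h1 := Nat.mul_le_mul hU hnb
    have h2 : b ^ 3 = b * b * b := by ring
    rw [h2]
    nlinarith [Nat.mul_le_mul hb hb]
  set K := f + lam with hK
  have hK1 : 1 ≤ K := by omega
  by_cases hsmall : q < K + 5
  · refine ⟨auctionCode n q 1 n one_pos (by omega), ?_, ?_, ?_, ?_, ?_, hsched _ _⟩
    · change q ≤ _
      omega
    · change q * 1 ≤ _
      omega
    · change n * q ≤ _
      nlinarith
    · change n ≤ _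
      omega
    · intro s P hP
      refine adversarialError_auctionCode _ _ ?_ hP
      rw [uavg_ind_bad_eq_zero]
      positivity
  · push Not at hsmall
    -- Rounding up makes the number of buckets exceed 2 * q, as Hall needs; the excess is at most K
    -- + 5 ≤ q, so it stays within 3 * q.
    set w := 2 * q / (K + 5) + 1 with hw
    have hkw1 : (K + 5) * (2 * q / (K + 5)) ≤ 2 * q := Nat.mul_div_le _ _
    have hkw2 : 2 * q < (K + 5) * w := Nat.lt_mul_div_succ _ (by omega)
    have hkw3 : (K + 5) * w ≤ 3 * q := by
      rw [hw, mul_add]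
      omega
    have hwpos : 0 < w := Nat.succ_pos _
    have hload1 : w * (6 * n / w) ≤ 6 * n := Nat.mul_div_le _ _
    have hload2 : 6 * n < w * (6 * n / w + 1) := Nat.lt_mul_div_succ _ hwpos
    have hle : 6 * n / w ≤ 6 * n := Nat.div_le_self _ _
    -- The first summand is six times the mean load, rounded down; K + 4 repairs the rounding and
    -- pushes the overflow probability below 2 ^ -(K + 4) per bucket.
    refine ⟨auctionCode n (K + 5) w (6 * n / w + K + 4) hwpos (Nat.succ_pos _), ?_, hkw3, ?_, ?_, ?_,
      hsched _ _⟩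
    · change K + 5 ≤ _
      omega
    -- The constant is 23 = 18 + 1 + 4: the load term gives 3 * n * (K + 5) ≤ 18 * n * K, and q ≤ n
    -- handles K * q and 4 * q.
    · change (6 * n / w + K + 4) * q ≤ _
      have h1 : (6 * n / w) * (2 * q) ≤ (6 * n / w) * ((K + 5) * w) :=
        Nat.mul_le_mul_left _ hkw2.le
      have h2 : (6 * n / w) * ((K + 5) * w) ≤ 6 * n * (K + 5) := by
        calc (6 * n / w) * ((K + 5) * w) = w * (6 * n / w) * (K + 5) := by ring
          _ ≤ 6 * n * (K + 5) := Nat.mul_le_mul_right _ hload1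
      have h3 : n ≤ n * K := Nat.le_mul_of_pos_right _ hK1
      have h4 : K * q ≤ n * K := by
        rw [mul_comm]
        exact Nat.mul_le_mul_right _ hqn
      nlinarith
    · change 6 * n / w + K + 4 ≤ _
      omega
    · intro s P hP
      refine adversarialError_auctionCode _ _ (uavg_ind_bad_le hwpos rfl
        (by rw [add_assoc _ K]; exact Nat.le_add_left _ _) ?_ hkw2.le
        (hkw3.trans (by omega)) hf) hP
      rw [add_assoc]
      exact hload2.le.trans (Nat.mul_le_mul_left _ (Nat.add_le_add_left (by omega) _))

end CuckooCode

/-- The little-o bound is applied with the constant log 2. -/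
theorem exists_forall_le_two_pow {f : ℕ → ℕ}
    (hf : (fun n : ℕ => Real.log (n : ℝ)) =o[atTop] (fun n : ℕ => (f n : ℝ))) :
    ∃ n₀ : ℕ, 2 ≤ n₀ ∧ ∀ n ≥ n₀, n ≤ 2 ^ f n := by
  have h := hf.bound (Real.log_pos one_lt_two)
  obtain ⟨N, hN⟩ := eventually_atTop.1 h
  refine ⟨max 2 N, le_max_left _ _, fun n hn => ?_⟩
  have hn2 : 2 ≤ n := (le_max_left _ _).trans hn
  have h1 := hN n ((le_max_right _ _).trans hn)
  have hnpos : (0 : ℝ) < n := by exact_mod_cast (by omega : 0 < n)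
  rw [Real.norm_of_nonneg (Nat.cast_nonneg _)] at h1
  have h2 : Real.log n ≤ Real.log ((2 : ℝ) ^ f n) := by
    rw [Real.log_pow, mul_comm]
    exact (le_abs_self _).trans h1
  have h3 := (Real.log_le_log_iff hnpos (by positivity)).1 h2
  exact_mod_cast h3

theorem mainTheorem12 (f : ℕ → ℕ)
    (hf : (fun n : ℕ => Real.log (n : ℝ)) =o[atTop] (fun n : ℕ => (f n : ℝ))) :
    ∃ (C n₀ : ℕ) (B : (lam n q : ℕ) → CuckooCode n),
      -- parameters of the batch code: `O(k)` hash functions, `O(q)` buckets,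
      -- bucket size `O(n * k / q + lam)`, where `k = f n + lam`
      (∀ lam n q : ℕ, n₀ ≤ n → 1 ≤ q → q ≤ n →
        (B lam n q).k ≤ C * (f n + lam) ∧
        (B lam n q).k * (B lam n q).w ≤ C * q ∧
        ((B lam n q).cap : ℝ) ≤ C * ((n : ℝ) * ((f n + lam : ℕ) : ℝ) / (q : ℝ) + (lam : ℝ))) ∧
      -- composition with an arbitrary single-query PIR
      ∀ (s : ℕ) (P : ℕ → (n : ℕ) → PIR s n),
        -- adversarial error
        ((∀ lam n : ℕ, 1 ≤ n → (P lam n).Correct) →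
          ∀ lam n q : ℕ, n₀ ≤ n → 1 ≤ q → q ≤ n →
            ((B lam n q).batchPIR (P lam (B lam n q).cap)).AdversarialError q
              ((1 / 2 : ℝ) ^ lam)) ∧
        -- communication
        (∀ c : ℕ → ℕ → ℕ, (∀ lam n : ℕ, 1 ≤ n → (P lam n).comm ≤ c lam n) →
          ∀ lam n q : ℕ, n₀ ≤ n → 1 ≤ q → q ≤ n →
            ((B lam n q).batchPIR (P lam (B lam n q).cap)).comm
              ≤ C * q * c lam (B lam n q).cap) ∧
        -- computation
        (∀ t : ℕ → ℕ, (∀ lam n : ℕ, 1 ≤ n → (P lam n).ServerWork (t lam * n)) →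
          ∀ lam n q : ℕ, n₀ ≤ n → 1 ≤ q → q ≤ n →
            ((B lam n q).batchPIR (P lam (B lam n q).cap)).ServerWork
              (C * t lam * (n * (f n + lam)))) ∧
        -- efficiency of encoding and of the client
        (∀ d : ℕ, (∀ lam n : ℕ, 1 ≤ n → (P lam n).EfficientWithin ((lam + n + 2) ^ d)) →
          ∃ d' : ℕ, ∀ lam n q : ℕ, n₀ ≤ n → 1 ≤ q → q ≤ n →
            ((B lam n q).batchPIR (P lam (B lam n q).cap)).EfficientWithin
              ((lam + n + 2) ^ d')) ∧
        -- privacy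
        (∀ (sA : ℕ) (δ : ℕ → ℕ → ℝ), SecurePIR P sA δ →
          ∀ d : ℕ, ∃ lam₀ : ℕ, ∀ lam ≥ lam₀, ∀ n q : ℕ, n₀ ≤ n → 1 ≤ q → q ≤ n →
            n ≤ lam ^ d →
            ((B lam n q).batchPIR (P lam (B lam n q).cap)).PrivateWithin q sA (lam ^ d)
              (C * q * δ lam (B lam n q).cap)) := by
  classical
  obtain ⟨n₀, hn₀, hpow⟩ := exists_forall_le_two_pow hf
  have hex : ∀ lam n q : ℕ, ∃ B : CuckooCode n, n₀ ≤ n → 1 ≤ q → q ≤ n →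
      B.k ≤ 6 * (f n + lam) ∧ B.k * B.w ≤ 3 * q ∧ B.cap * q ≤ 23 * (n * (f n + lam)) ∧
      B.cap ≤ 7 * n ∧
      (∀ (s : ℕ) (P : PIR s B.cap), P.Correct →
        (B.batchPIR P).AdversarialError q ((1 / 2 : ℝ) ^ lam)) ∧
      ∀ b : ℕ, 8 ≤ b → n + 1 ≤ b → B.k * B.w ≤ b → B.ScheduleWithin (b ^ 21) := by
    intro lam n q
    by_cases h : n₀ ≤ n ∧ 1 ≤ q ∧ q ≤ n
    · obtain ⟨B, hB⟩ := CuckooCode.exists_auctionCode (lam := lam) (hn₀.trans h.1) (hpow n h.1)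
        h.2.1 h.2.2
      exact ⟨B, fun _ _ _ => hB⟩
    -- An arbitrary code outside the range where anything is claimed.
    · exact ⟨CuckooCode.auctionCode n 0 1 1 one_pos one_pos,
        fun h1 h2 h3 => absurd ⟨h1, h2, h3⟩ h⟩
  choose B hB using hex
  -- The constant is 69 = 3 * 23, from 3 * q buckets and the bound on `cap * q` in the server work.
  refine ⟨69, n₀, B, fun lam n q h1 h2 h3 => ?_, fun s P => ⟨fun hP lam n q h1 h2 h3 => ?_,
    fun c hc lam n q h1 h2 h3 => ?_, fun t ht lam n q h1 h2 h3 => ?_, fun d hd => ?_,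
    fun sA δ hδ d => ?_⟩⟩
  · obtain ⟨hk, hkw, hcap, -⟩ := hB lam n q h1 h2 h3
    refine ⟨hk.trans (Nat.mul_le_mul_right _ (by norm_num)),
      hkw.trans (Nat.mul_le_mul_right _ (by norm_num)), ?_⟩
    have hq : (0 : ℝ) < q := by exact_mod_cast h2
    have hcap' : ((B lam n q).cap : ℝ) ≤ 23 * ((n : ℝ) * ((f n + lam : ℕ) : ℝ) / q) := by
      rw [← mul_div_assoc, le_div_iff₀ hq]
      exact_mod_cast hcap
    have hx : (0 : ℝ) ≤ (n : ℝ) * ((f n + lam : ℕ) : ℝ) / q := by positivity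
    have hl : (0 : ℝ) ≤ lam := Nat.cast_nonneg _
    push_cast at hcap' hx ⊢
    linarith
  · exact (hB lam n q h1 h2 h3).2.2.2.2.1 s _ (hP _ _ (B lam n q).cap_pos)
  · rw [CuckooCode.comm_batchPIR]
    have hkw := (hB lam n q h1 h2 h3).2.1
    exact Nat.mul_le_mul (by omega) (hc _ _ (B lam n q).cap_pos)
  · obtain ⟨-, hkw, hcap, -⟩ := hB lam n q h1 h2 h3
    refine ((B lam n q).serverWork_batchPIR _ (ht lam _ (B lam n q).cap_pos)).mono ?_
    calc (B lam n q).k * (B lam n q).w * (t lam * (B lam n q).cap)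
        ≤ 3 * q * (t lam * (B lam n q).cap) := Nat.mul_le_mul_right _ hkw
      _ = 3 * t lam * ((B lam n q).cap * q) := by ring
      _ ≤ 3 * t lam * (23 * (n * (f n + lam))) := Nat.mul_le_mul_left _ hcap
      _ = 69 * t lam * (n * (f n + lam)) := by ring
  -- The base for all circuit bounds is b = N ^ 4 ≥ 64 * N, which dominates n + 1, the number of
  -- buckets, and lam plus the capacity.
  · refine ⟨4 * (d + 40), fun lam n q h1 h2 h3 => ?_⟩
    obtain ⟨-, hkw, -, hcap, -, hS⟩ := hB lam n q h1 h2 h3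
    rw [pow_mul]
    set N := lam + n + 2 with hN
    have h64 : 64 * N ≤ N ^ 4 := by
      calc 64 * N = 4 ^ 3 * N := by norm_num
        _ ≤ N ^ 3 * N := Nat.mul_le_mul_right _ (Nat.pow_le_pow_left (by omega) 3)
        _ = N ^ 4 := by ring
    exact (B lam n q).efficientWithin_batchPIR _ (by omega) (by omega) (by omega) (by omega)
      ((hd lam _ (B lam n q).cap_pos).mono (Nat.pow_le_pow_left (by omega) d))
      (hS _ (by omega) (by omega) (by omega))
  -- The single-query databases have size up to 7 * n ≤ lam ^ (d + 1) once lam ≥ 7, so security is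
  -- invoked one exponent higher.
  · obtain ⟨lam₀, hlam₀⟩ := hδ (d + 1)
    refine ⟨max lam₀ 7, fun lam hlam n q h1 h2 h3 hn => ?_⟩
    obtain ⟨-, hkw, -, hcap, -⟩ := hB lam n q h1 h2 h3
    have hlam7 : 7 ≤ lam := (le_max_right _ _).trans hlam
    have hsize : (B lam n q).cap ≤ lam ^ (d + 1) := by
      rw [pow_succ, mul_comm]
      exact hcap.trans (Nat.mul_le_mul hlam7 hn)
    have hpriv := (hlam₀ lam ((le_max_left _ _).trans hlam) _ (B lam n q).cap_pos hsize).anti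
      (Nat.pow_le_pow_right (by omega) (Nat.le_succ d))
    have hδ0 := hpriv.nonneg ⟨0, (B lam n q).cap_pos⟩
    intro r A hA
    refine ((B lam n q).privateWithin_batchPIR hpriv q r A hA).trans
      (mul_le_mul_of_nonneg_right ?_ hδ0)
    have : (B lam n q).k * (B lam n q).w ≤ 69 * q := by omega
    exact_mod_cast this
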